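/- Let $Q$ be a Hausdorff smooth finite-dimensional manifold (without boundary) with a smooth Riemannian metric $\langle\langle\cdot,\cdot\rangle\rangle$, let $U:Q\to\mathbb R$ be smooth, and consider the simple mechanical system with Lagrangian $L(v_q)=K(v_q)-U(q)$, $K(v_q)=\frac12\langle\langle v_q,v_q\rangle\rangle$. Its Legendre transformation $\mathbb FL:TQ\to T^*Q$ is $\langle\mathbb FL(v_q),w_q\rangle=\langle\langle v_q,w_q\rangle\rangle$, and its Hamiltonian is $H(p_q)=K(\mathbb FL^{-1}(p_q))+U(q)$ on $T^*Q$ with the canonical one-form $\theta_0$ and symplectic form $\omega_0=-d\theta_0$; $X_H$ is defined by $i_{X_H}\omega_0=dH$. Let $\Psi$ be a smooth action of the multiplicative group $\mathbb R^+$ on $Q$ and let $a,b\in\mathbb R$ be such that $U(\Psi_g(q))=g^bU(q)$ and $K(T\Psi_g(v_q))=g^aK(v_q)$ for all $g\in\mathbb R^+$, $q\in Q$, $v_q\in T_qQ$. Put $c=\frac{a+b}2$ and let $\Phi=\hat\Psi^c$ be the scaled cotangent lifted action on $T^*Q$, $\langle\hat\Psi^c_g(\alpha),v\rangle=g^c\langle\alpha,T\Psi_{g^{-1}}v\rangle$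 for $\alpha\in T_q^*Q$, $v\in T_{\Psi_g(q)}Q$. For $\xi\in\mathbb R$ let $\xi_Q(q)=\frac{d}{d\tau}\big|_{\tau=0}\Psi_{e^{\tau\xi}}(q)$ be the infinitesimal generator, let $\langle\eta,\mathbb I(q)\xi\rangle=\langle\langle\xi_Q(q),\eta_Q(q)\rangle\rangle$ be the locked inertia tensor, $U_\xi(q)=U(q)-\frac12\langle\xi,\mathbb I(q)\xi\rangle$ the augmented potential, and $\theta_L=(\mathbb FL)^*\theta_0$ the Lagrangian one-form on $TQ$. A point $z\in T^*Q$ is called a relative equilibrium of the scaling symmetry if its maximal integral curve $\gamma:I\to T^*Q$ of $X_H$, $\gamma(0)=z$, satisfies $\gamma(t)=\Phi_{\eta(t)}(z)$ for all $t\in I$, for some function $\eta:I\to\mathbb R^+$ with $\eta(0)=1$; it is called a local relative equilibrium if this holds for all $t$ in some neighbourhood of $0$. For $p_q\in T_q^*Q$ consider the condition (C) there is $\xi\in\mathbb R$ such that $p_q=\mathbb FL(\xi_Q(q))$ and $dU_\xi(q)+(c\xi)\,\theta_L(\xi_Q(q))=0$, where $\theta_L(\xi_Q(q))$ is the value of $\theta_L$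 at the point $\xi_Q(q)\in TQ$ and $dU_\xi(q)$ is pulled back to $T_{\xi_Q(q)}(TQ)$ by the projection $TQ\to Q$. Then, for every $p_q\in T^*Q$: 1. $p_q$ is a relative equilibrium if and only if (C) holds and the maximal integral curve of $X_H$ through $p_q$ does not meet the set of fixed points of $\Phi$ unless $p_q$ is itself a fixed point of $\Phi$. 2. $p_q$ is a local relative equilibrium if and only if (C) holds. 3. If $\Psi$ has no fixed point in $Q$, then $p_q$ is a relative equilibrium if and only if (C) holds. -/

import Mathlib

open Set Filter Topology Bundle
open scoped Manifold ContDiff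

noncomputable section

namespace ScalingMechanics

/-- The multiplicative group `ℝ⁺` of positive reals (Mathlib provides its group structure). -/
abbrev PosReal : Type := {x : ℝ // 0 < x}

/-- The exponential map `ℝ = Lie(ℝ⁺) → ℝ⁺`. -/
def posExp (t : ℝ) : PosReal := ⟨Real.exp t, Real.exp_pos t⟩

section ExteriorDerivative

variable {F : Type*} [NormedAddCommGroup F] [NormedSpace ℝ F] {H : Type*} [TopologicalSpace H]
  (J : ModelWithCorners ℝ F H) {M : Type*} [TopologicalSpace M] [ChartedSpace H M]

/-- The coordinate expression of a one-form `α` in the preferred chart `φ` at `z`: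
the pull-back of `α` under `φ⁻¹`, a map from the model space `F` to its dual. -/
def localOneForm (α : ∀ x : M, TangentSpace J x →L[ℝ] ℝ) (z : M) : F → (F →L[ℝ] ℝ) :=
  fun u => (α ((extChartAt J z).symm u)).comp (mfderiv 𝓘(ℝ, F) J (extChartAt J z).symm u)

/-- The exterior derivative `dα` at `z` of a one-form `α` on a manifold without boundary, as the
bilinear form `v ↦ w ↦ dα(v, w)`: with `A` the coordinate expression of `α` in the chart `φ` at `z`
and `v' = Tφ v`, `w' = Tφ w`, it is `dα(v, w) = (D_{v'} A) w' - (D_{w'} A) v'`. -/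
def extDerivOneForm (α : ∀ x : M, TangentSpace J x →L[ℝ] ℝ) (z : M) :
    TangentSpace J z →L[ℝ] TangentSpace J z →L[ℝ] ℝ :=
  let D : F →L[ℝ] F →L[ℝ] ℝ := fderiv ℝ (localOneForm J α z) (extChartAt J z z)
  let T : TangentSpace J z →L[ℝ] F := mfderiv J 𝓘(ℝ, F) (extChartAt J z) z
  (ContinuousLinearMap.precomp ℝ T).comp ((D - D.flip).comp T)

end ExteriorDerivative

section IntegralCurves

variable {F : Type*} [NormedAddCommGroup F] [NormedSpace ℝ F] {H : Type*} [TopologicalSpace H]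
  {J : ModelWithCorners ℝ F H} {M : Type*} [TopologicalSpace M] [ChartedSpace H M]

/-- `γ` is an integral curve of the vector field `X` on the open interval `S` containing `0`,
with initial condition `γ 0 = z`. -/
structure IsIntegralCurveFrom (X : ∀ x : M, TangentSpace J x) (z : M) (γ : ℝ → M) (S : Set ℝ) :
    Prop where
  isOpen : IsOpen S
  ordConnected : S.OrdConnected
  zero_mem : (0 : ℝ) ∈ S
  initial : γ 0 = z
  integral : IsMIntegralCurveOn γ X S

/-- `γ` (restricted to the open interval `S`) is the maximal integral curve of `X` starting
at `z`: it extends every integral curve of `X` starting at `z`. -/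
structure IsMaximalIntegralCurve (X : ∀ x : M, TangentSpace J x) (z : M) (γ : ℝ → M) (S : Set ℝ) :
    Prop extends IsIntegralCurveFrom X z γ S where
  maximal : ∀ (δ : ℝ → M) (S' : Set ℝ), IsIntegralCurveFrom X z δ S' → S' ⊆ S ∧ EqOn δ γ S'

/-- `z` is a relative equilibrium of the vector field `X` with respect to the maps
`Φ g`, `g ∈ ℝ⁺`: the maximal integral curve of `X` through `z` is `γ t = Φ (η t) z` with
`η 0 = 1`, for all times of its maximal interval of definition. -/
def IsRelativeEquilibrium (X : ∀ x : M, TangentSpace J x) (Φ : PosReal → M → M) (z : M) : Prop :=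
  ∃ (γ : ℝ → M) (S : Set ℝ), IsMaximalIntegralCurve X z γ S ∧
    ∃ η : ℝ → PosReal, η 0 = 1 ∧ ∀ t ∈ S, γ t = Φ (η t) z

/-- The same as `IsRelativeEquilibrium`, but only for all sufficiently small times `t`. -/
def IsLocalRelativeEquilibrium (X : ∀ x : M, TangentSpace J x) (Φ : PosReal → M → M) (z : M) :
    Prop :=
  ∃ (γ : ℝ → M) (S : Set ℝ), IsMaximalIntegralCurve X z γ S ∧
    ∃ η : ℝ → PosReal, η 0 = 1 ∧ ∀ᶠ t in 𝓝 (0 : ℝ), γ t = Φ (η t) z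

/-- The maximal integral curve of `X` through `z` does not meet the common fixed points of the
maps `Φ g`, unless `z` is itself one of them. -/
def AvoidsFixedPoints (X : ∀ x : M, TangentSpace J x) (Φ : PosReal → M → M) (z : M) : Prop :=
  ∀ (γ : ℝ → M) (S : Set ℝ), IsMaximalIntegralCurve X z γ S →
    ∀ t ∈ S, (∀ g, Φ g (γ t) = γ t) → ∀ g, Φ g z = z

end IntegralCurves

variable {E : Type*} [NormedAddCommGroup E] [NormedSpace ℝ E]

section Manifold

variable (E) (Q : Type*) [TopologicalSpace Q] [ChartedSpace E Q] [IsManifold 𝓘(ℝ, E) ∞ Q]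

/-- The cotangent bundle `T*Q`, with Mathlib's vector bundle and manifold structure. -/
abbrev CotangentBundle : Type _ :=
  TotalSpace (E →L[ℝ] ℝ) (fun q : Q => TangentSpace 𝓘(ℝ, E) q →L[ℝ] ℝ)

/-- The model with corners of `T*Q`. -/
abbrev cotangentModel : ModelWithCorners ℝ (E × (E →L[ℝ] ℝ)) (ModelProd E (E →L[ℝ] ℝ)) :=
  𝓘(ℝ, E).prod 𝓘(ℝ, E →L[ℝ] ℝ)

/-- A smooth Riemannian metric on `Q`. -/
abbrev Metric : Type _ :=
  ContMDiffRiemannianMetric 𝓘(ℝ, E) ∞ E (fun q : Q => TangentSpace 𝓘(ℝ, E) q)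

/-- A smooth action `Ψ` of the Lie group `ℝ⁺` on `Q`. Smoothness in the group variable is expressed
through the Lie group isomorphism `exp : ℝ → ℝ⁺`. -/
structure ScalingAction where
  act : PosReal → Q → Q
  one_act : ∀ q, act 1 q = q
  mul_act : ∀ g h q, act (g * h) q = act g (act h q)
  smooth : ContMDiff (𝓘(ℝ, ℝ).prod 𝓘(ℝ, E)) 𝓘(ℝ, E) ∞ (fun p : ℝ × Q => act (posExp p.1) p.2)

end Manifold

variable {Q : Type*} [TopologicalSpace Q] [ChartedSpace E Q] [IsManifold 𝓘(ℝ, E) ∞ Q]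

/-- The infinitesimal generator `ξ_Q(q) = d/dτ|_{τ = 0} Ψ_{exp(τ ξ)}(q)`. -/
def ScalingAction.generator (Ψ : ScalingAction E Q) (ξ : ℝ) (q : Q) : TangentSpace 𝓘(ℝ, E) q :=
  (mfderiv 𝓘(ℝ, ℝ) 𝓘(ℝ, E) (fun τ : ℝ => Ψ.act (posExp (τ * ξ)) q) 0 : ℝ →L[ℝ] E) 1

/-- The scaled cotangent lift `⟨Ψ̂^c_g(α), v⟩ = ⟨α, g^c TΨ_{g⁻¹} v⟩` for `α ∈ T*_q Q`,
`v ∈ T_{Ψ_g(q)} Q`. -/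
def ScalingAction.cotangentLift (Ψ : ScalingAction E Q) (c : ℝ) (g : PosReal)
    (α : CotangentBundle E Q) : CotangentBundle E Q :=
  ⟨Ψ.act g α.1, (g : ℝ) ^ c •
    ((α.2 : E →L[ℝ] ℝ).comp
      (mfderiv 𝓘(ℝ, E) 𝓘(ℝ, E) (Ψ.act g⁻¹) (Ψ.act g α.1) : E →L[ℝ] E) : E →L[ℝ] ℝ)⟩

/-- The canonical one-form `⟨θ₀(β), v⟩ = ⟨β, Tπ_Q v⟩` on `T*Q`. -/
def canonicalOneForm (β : CotangentBundle E Q) :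
    TangentSpace (cotangentModel E) β →L[ℝ] ℝ :=
  β.2.comp (mfderiv (cotangentModel E) 𝓘(ℝ, E) (fun α : CotangentBundle E Q => α.1) β)

/-- The canonical symplectic form `ω₀ = -dθ₀` on `T*Q`, as the map `v ↦ i_v ω₀`. -/
def canonicalTwoForm (β : CotangentBundle E Q) :
    TangentSpace (cotangentModel E) β →L[ℝ] TangentSpace (cotangentModel E) β →L[ℝ] ℝ :=
  -extDerivOneForm (cotangentModel E) canonicalOneForm β

/-- The Hamiltonian vector field `X_H` on `T*Q`: the unique solution of `i_{X_H} ω₀ = dH`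
(`ω₀` is non-degenerate, so that `v ↦ i_v ω₀` is invertible when `Q` is finite-dimensional). -/
def hamiltonianVectorField (H : CotangentBundle E Q → ℝ) (β : CotangentBundle E Q) :
    TangentSpace (cotangentModel E) β :=
  (canonicalTwoForm β).inverse (mfderiv (cotangentModel E) 𝓘(ℝ, ℝ) H β)

/-- The kinetic energy `K(v_q) = ½ ‖v_q‖²` on `TQ`. -/
def kineticEnergy (m : Metric E Q) (v : TangentBundle 𝓘(ℝ, E) Q) : ℝ :=
  1 / 2 * m.inner v.1 v.2 v.2

/-- The Legendre transformation `𝔽L : TQ → T*Q`, `⟨𝔽L(v_q), w_q⟩ = ⟪v_q, w_q⟫`, of a simple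
mechanical system. -/
def legendre (m : Metric E Q) (v : TangentBundle 𝓘(ℝ, E) Q) : CotangentBundle E Q :=
  ⟨v.1, m.inner v.1 v.2⟩

/-- The inverse Legendre transformation `𝔽L⁻¹ : T*Q → TQ` (on each fibre, `v ↦ ⟪v, ·⟫` is
invertible when `Q` is finite-dimensional). -/
def legendreInv (m : Metric E Q) (p : CotangentBundle E Q) : TangentBundle 𝓘(ℝ, E) Q :=
  ⟨p.1, (m.inner p.1).inverse p.2⟩

/-- The Hamiltonian `H(p_q) = K(𝔽L⁻¹(p_q)) + U(q)` corresponding to the Lagrangian `L = K - U`. -/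
def hamiltonian (m : Metric E Q) (U : Q → ℝ) (p : CotangentBundle E Q) : ℝ :=
  kineticEnergy m (legendreInv m p) + U p.1

/-- The locked inertia tensor, `⟨η, 𝕀(q) ξ⟩ = ⟪ξ_Q(q), η_Q(q)⟫`. -/
def lockedInertia (m : Metric E Q) (Ψ : ScalingAction E Q) (q : Q) (η ξ : ℝ) : ℝ :=
  m.inner q (Ψ.generator ξ q) (Ψ.generator η q)

/-- The augmented potential `U_ξ(q) = U(q) - ½ ⟨ξ, 𝕀(q) ξ⟩`. -/
def augmentedPotential (m : Metric E Q) (U : Q → ℝ) (Ψ : ScalingAction E Q) (ξ : ℝ) (q : Q) : ℝ :=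
  U q - 1 / 2 * lockedInertia m Ψ q ξ ξ

/-- The Lagrangian one-form `θ_L = (𝔽L)^* θ₀` on `TQ`. -/
def lagrangianOneForm (m : Metric E Q) (v : TangentBundle 𝓘(ℝ, E) Q) :
    TangentSpace 𝓘(ℝ, E).tangent v →L[ℝ] ℝ :=
  (canonicalOneForm (legendre m v)).comp
    (mfderiv 𝓘(ℝ, E).tangent (cotangentModel E) (legendre m) v)

/-- The equation `dU_ξ(q) + (c ξ) θ_L(ξ_Q(q)) = 0`. Here `θ_L(ξ_Q(q))` is the value of the one-form
`θ_L` on `TQ` at the point `ξ_Q(q)` of `TQ`, a covector on `T_{ξ_Q(q)}(TQ)`, and the covector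
`dU_ξ(q)` on `T_q Q` is regarded as one on `T_{ξ_Q(q)}(TQ)` through the projection `TQ → Q`. -/
def CentralConfigurationEquation (m : Metric E Q) (U : Q → ℝ) (Ψ : ScalingAction E Q) (c ξ : ℝ)
    (q : Q) : Prop :=
  let v : TangentBundle 𝓘(ℝ, E) Q := ⟨q, Ψ.generator ξ q⟩
  let dU : TangentSpace 𝓘(ℝ, E) q →L[ℝ] ℝ :=
    mfderiv 𝓘(ℝ, E) 𝓘(ℝ, ℝ) (augmentedPotential m U Ψ ξ) q
  ∀ w : TangentSpace 𝓘(ℝ, E).tangent v,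
    dU (mfderiv 𝓘(ℝ, E).tangent 𝓘(ℝ, E) (fun u : TangentBundle 𝓘(ℝ, E) Q => u.1) v w) +
      c * ξ * lagrangianOneForm m v w = 0

end ScalingMechanics

end

/-! Write `θ` and `ω` for the canonical forms on `T*Q`, `Φ` for the scaled lift, `Z` for its
generator (`liftVel`), `J` for the function `⟨p_q, 1_Q(q)⟩` (`momentumFunction`), and `k = b - c`.

Scaling. The lift multiplies `θ`, hence `ω`, by `g^c`, and the choice of `c` makes it multiply `H`
by `g^b`. So `X_H(Φ_g z) = g^k TΦ_g X_H(z)` (`hamiltonianVector_cotangentLift`).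

Infinitesimal criterion. Condition (C) for `ξ` says exactly that `X_H(z) = ξ Z(z)`
(`centralConfiguration_iff`). Two identities give this. The first is `i_Z ω = dJ - c θ`
(`modelTwoForm_liftVel`). The second completes a square: `H - ξ J - U_ξ` is half the squared norm of
`p^♯ - ξ 1_Q`, so its differential vanishes where `p = 𝔽L(ξ_Q)` (`tderiv_hamiltonian_eq`). The
equation `p = 𝔽L(ξ_Q)` itself is the projection of `X_H = ξ Z` to `Q`.

From curves to tangency. The function `η` of a relative equilibrium is not assumed continuous, so it
cannot be differentiated. If `X_H(z)` were not a multiple of `Z(z) ≠ 0`, then `(s, t) ↦ Φ_{e^s}(γ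
t)` would be injective near `0`, while a countability argument produces a collision
(`exists_eq_smul_of_flow`).

From tangency to curves. If `X_H(z) = ξ Z(z)`, then `Φ_{e^σ(t)}(z)` is an integral curve when `σ' =
ξ e^{kσ}` and `σ 0 = 0`, that is, as long as `k ξ t < 1`. If the maximal curve survives beyond that,
its value at `t = (kξ)⁻¹` is fixed by every `Φ_g`, because the scaling symmetry permutes the
approach to that instant (`exists_fixedPoint_of_not_subset`). Conversely, an orbit containing a
fixed point is that point alone. This accounts for the avoidance condition in the global statement,
and for its absence when `Ψ` has no fixed points. -/

noncomputable section

namespace ScalingMechanics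

/-! ### Bundle projections in the preferred charts. -/

section TotalSpaceProjection

variable {F E H B : Type*} [NormedAddCommGroup E] [NormedSpace ℝ E] [NormedAddCommGroup F]
  [NormedSpace ℝ F] [TopologicalSpace H] {I : ModelWithCorners ℝ E H}
  [TopologicalSpace B] [ChartedSpace H B] {V : B → Type*} [TopologicalSpace (TotalSpace F V)]
  [∀ x, TopologicalSpace (V x)] [FiberBundle F V]

lemma extChartAt_totalSpace_fst (x y : TotalSpace F V)
    (hy : y.1 ∈ (trivializationAt F V x.1).baseSet) :
    (extChartAt (I.prod 𝓘(ℝ, F)) x y).1 = extChartAt I x.1 y.1 := by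
  rw [FiberBundle.extChartAt]
  simp [(trivializationAt F V x.1).coe_fst' hy]

lemma extChartAt_totalSpace_snd (x y : TotalSpace F V) :
    (extChartAt (I.prod 𝓘(ℝ, F)) x y).2 = (trivializationAt F V x.1 y).2 := by
  rw [FiberBundle.extChartAt]
  simp

lemma extChartAt_totalSpace_symm_proj (x : TotalSpace F V) {u : E × F}
    (hu : u ∈ (extChartAt (I.prod 𝓘(ℝ, F)) x).target) :
    ((extChartAt (I.prod 𝓘(ℝ, F)) x).symm u).1 = (extChartAt I x.1).symm u.1 := by
  rw [FiberBundle.extChartAt_target] at hu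
  rw [FiberBundle.extChartAt]
  simpa using (trivializationAt F V x.1).proj_symm_apply' hu.1.2

/-- In the preferred charts, the derivative of a bundle projection is the first projection. -/
lemma hasMFDerivAt_totalSpace_proj (x : TotalSpace F V) :
    HasMFDerivAt (I.prod 𝓘(ℝ, F)) I (fun y : TotalSpace F V => y.1) x
      (ContinuousLinearMap.fst ℝ E F) := by
  refine ⟨(contMDiffAt_proj (n := 0) (IB := I) V).continuousAt, ?_⟩
  refine HasFDerivWithinAt.congr_of_eventuallyEq (hasFDerivWithinAt_fst) ?_ ?_
  · filter_upwards [extChartAt_target_mem_nhdsWithin (I := I.prod 𝓘(ℝ, F)) x] with u hu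
    have hu' := hu
    rw [FiberBundle.extChartAt_target] at hu'
    change extChartAt I x.1 ((extChartAt (I.prod 𝓘(ℝ, F)) x).symm u).1 = u.1
    rw [extChartAt_totalSpace_symm_proj x hu]
    exact (extChartAt I x.1).right_inv hu'.1.1
  · simp only [writtenInExtChartAt, Function.comp]
    rw [extChartAt_to_inv,
      extChartAt_totalSpace_fst x x (FiberBundle.mem_baseSet_trivializationAt' _)]

lemma mfderiv_totalSpace_proj (x : TotalSpace F V) :
    mfderiv (I.prod 𝓘(ℝ, F)) I (fun y : TotalSpace F V => y.1) x =
      ContinuousLinearMap.fst ℝ E F :=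
  (hasMFDerivAt_totalSpace_proj x).mfderiv

end TotalSpaceProjection

/-! ### Linear symplectic algebra on `E × E*`. -/

section LinearOneForm

variable {W : Type*} [NormedAddCommGroup W] [NormedSpace ℝ W]

/-- Minus the exterior derivative of a one-form `A` on a vector space which depends linearly on the
point. -/
def twoFormOf (A : W →L[ℝ] W →L[ℝ] ℝ) : W →L[ℝ] W →L[ℝ] ℝ := -(A - A.flip)

@[simp] lemma twoFormOf_apply (A : W →L[ℝ] W →L[ℝ] ℝ) (v w : W) :
    twoFormOf A v w = A w v - A v w := by
  change -(A v w - A w v) = _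
  ring

/-- Dimension count, applied to the symplectic form and to the metric. `ContinuousLinearMap.inverse`
is `0` on maps that are not invertible, so the Hamiltonian vector field and the inverse Legendre
transformation have their intended meaning only through this lemma. -/
lemma isInvertible_of_injective_toDual [FiniteDimensional ℝ W] {B : W →L[ℝ] W →L[ℝ] ℝ}
    (hB : Function.Injective B) : B.IsInvertible := by
  have hd : Module.finrank ℝ W = Module.finrank ℝ (W →L[ℝ] ℝ) := by
    rw [← (LinearMap.toContinuousLinearMap (𝕜 := ℝ) (E := W) (F' := ℝ)).finrank_eq]
    exact (Subspace.dual_finrank_eq (K := ℝ) (V := W)).symm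
  exact ⟨(LinearEquiv.ofInjectiveOfFinrankEq (B : W →ₗ[ℝ] (W →L[ℝ] ℝ))
    hB hd).toContinuousLinearEquiv, by ext; rfl⟩

/-- A map which multiplies the one-form `A` by `r` multiplies its exterior derivative by `r`. -/
lemma twoFormOf_fderiv (A : W →L[ℝ] W →L[ℝ] ℝ) {G : W → W} {u₀ : W}
    (hG : ContDiffAt ℝ 2 G u₀) {r : ℝ}
    (h : ∀ᶠ u in 𝓝 u₀, ∀ w, A (G u) (fderiv ℝ G u w) = r * A u w) (v w : W) :
    twoFormOf A (fderiv ℝ G u₀ v) (fderiv ℝ G u₀ w) = r * twoFormOf A v w := by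
  have hd : HasFDerivAt G (fderiv ℝ G u₀) u₀ := (hG.differentiableAt (by simp)).hasFDerivAt
  have hdd : HasFDerivAt (fderiv ℝ G) (fderiv ℝ (fderiv ℝ G) u₀) u₀ :=
    ((hG.fderiv_right (m := 1) (by norm_num)).differentiableAt (by simp)).hasFDerivAt
  -- The identity `G^*A = r A`, evaluated on the fixed vector `w` and differentiated in the
  -- direction `v`.
  have key (w v) : A (fderiv ℝ G u₀ v) (fderiv ℝ G u₀ w) +
      A (G u₀) (fderiv ℝ (fderiv ℝ G) u₀ v w) = r * A v w := by
    have h1 : HasFDerivAt (fun u => A (G u) (fderiv ℝ G u w)) _ u₀ :=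
      (A.hasFDerivAt.comp u₀ hd).clm_apply (hdd.clm_apply (hasFDerivAt_const w u₀))
    have h2 : HasFDerivAt (fun u : W => r * A u w) _ u₀ :=
      ((A.hasFDerivAt (x := u₀)).clm_apply (hasFDerivAt_const w u₀)).const_mul r
    have h3 := h1.unique (h2.congr_of_eventuallyEq (h.mono fun u hu => hu w))
    have := congrArg (fun L => L v) h3
    simp at this
    linarith
  -- Antisymmetrising `key` in `v` and `w` removes the second derivative of `G`.
  have hs : fderiv ℝ (fderiv ℝ G) u₀ v w = fderiv ℝ (fderiv ℝ G) u₀ w v :=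
    hG.isSymmSndFDerivAt (by simp) v w
  have h1 := key w v
  have h2 := key v w
  rw [hs] at h1
  simp only [twoFormOf_apply]
  linarith

end LinearOneForm

section VectorSpace

variable (E : Type*) [NormedAddCommGroup E] [NormedSpace ℝ E]

/-- The canonical one-form `(x, p) ↦ p dx` on `E × E*`. -/
def modelOneForm : (E × (E →L[ℝ] ℝ)) →L[ℝ] (E × (E →L[ℝ] ℝ)) →L[ℝ] ℝ :=
  (ContinuousLinearMap.precomp ℝ (ContinuousLinearMap.fst ℝ E (E →L[ℝ] ℝ))).comp
    (ContinuousLinearMap.snd ℝ E (E →L[ℝ] ℝ))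

/-- The canonical symplectic form on `E × E*`. -/
def modelTwoForm : (E × (E →L[ℝ] ℝ)) →L[ℝ] (E × (E →L[ℝ] ℝ)) →L[ℝ] ℝ :=
  twoFormOf (modelOneForm E)

variable {E}

@[simp] lemma modelOneForm_apply (u w : E × (E →L[ℝ] ℝ)) : modelOneForm E u w = u.2 w.1 := rfl

@[simp] lemma modelTwoForm_apply (v w : E × (E →L[ℝ] ℝ)) :
    modelTwoForm E v w = w.2 v.1 - v.2 w.1 := by
  simp [modelTwoForm]

/-- Vertical test vectors `(0, f)`, with `f` a norming functional, force `v.1 = 0`; horizontal ones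
`(x, 0)` force `v.2 = 0`. -/
lemma eq_zero_of_modelTwoForm {v : E × (E →L[ℝ] ℝ)}
    (h : ∀ w : E × (E →L[ℝ] ℝ), w.2 v.1 - v.2 w.1 = 0) : v = 0 := by
  refine Prod.ext ?_ ?_
  · by_contra hne
    obtain ⟨f, -, hf⟩ := exists_dual_vector ℝ v.1 (norm_ne_zero_iff.2 hne)
    have := h (0, f)
    simp only [map_zero, sub_zero] at this
    rw [this] at hf
    exact hne (norm_eq_zero.1 (by simpa using hf.symm))
  · ext x
    simpa using h (x, 0)

lemma modelTwoForm_ext {v v' : E × (E →L[ℝ] ℝ)}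
    (h : ∀ w, modelTwoForm E v w = modelTwoForm E v' w) : v = v' := by
  rw [← sub_eq_zero]
  refine eq_zero_of_modelTwoForm fun w => ?_
  have := h w
  simp only [modelTwoForm_apply] at this
  simp only [Prod.fst_sub, Prod.snd_sub, map_sub, sub_apply]
  linarith

lemma modelTwoForm_isInvertible [FiniteDimensional ℝ E] :
    (modelTwoForm E).IsInvertible :=
  isInvertible_of_injective_toDual fun v v' h => modelTwoForm_ext fun w => by rw [h]

end VectorSpace

/-! ### Manifold derivatives with values in the model spaces, and derivatives of charts. -/

section Derivative

variable {F F' F'' H H' H'' M M' M'' : Type*} [NormedAddCommGroup F] [NormedSpace ℝ F]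
  [NormedAddCommGroup F'] [NormedSpace ℝ F'] [NormedAddCommGroup F''] [NormedSpace ℝ F'']
  [TopologicalSpace H] [TopologicalSpace H'] [TopologicalSpace H'']
  (I : ModelWithCorners ℝ F H) (I' : ModelWithCorners ℝ F' H') (I'' : ModelWithCorners ℝ F'' H'')
  [TopologicalSpace M] [ChartedSpace H M] [TopologicalSpace M'] [ChartedSpace H' M']
  [TopologicalSpace M''] [ChartedSpace H'' M'']

lemma fderiv_eq_of_eventuallyEq_clm {f : F → F'} {L : F →L[ℝ] F'} {x : F} (h : f =ᶠ[𝓝 x] L) :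
    fderiv ℝ f x = L := by
  rw [h.fderiv_eq, L.fderiv]

/-- The derivative of a map between manifolds, with the tangent spaces identified with the model
vector spaces. -/
def tderiv (f : M → M') (x : M) : F →L[ℝ] F' := mfderiv I I' f x

variable {I I' I''}

lemma extDerivOneForm_apply (α : ∀ x : M, TangentSpace I x →L[ℝ] ℝ) (x : M) (v w : F) :
    extDerivOneForm I α x v w =
      fderiv ℝ (localOneForm I α x) (extChartAt I x x)
        (tderiv I 𝓘(ℝ, F) (extChartAt I x) x v) (tderiv I 𝓘(ℝ, F) (extChartAt I x) x w) -
      fderiv ℝ (localOneForm I α x) (extChartAt I x x)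
        (tderiv I 𝓘(ℝ, F) (extChartAt I x) x w) (tderiv I 𝓘(ℝ, F) (extChartAt I x) x v) :=
  rfl

lemma tderiv_comp {g : M' → M''} {f : M → M'} (x : M) (hg : MDifferentiableAt I' I'' g (f x))
    (hf : MDifferentiableAt I I' f x) :
    tderiv I I'' (fun y => g (f y)) x = (tderiv I' I'' g (f x)).comp (tderiv I I' f x) :=
  mfderiv_comp x hg hf

lemma tderiv_congr {f g : M → M'} {x : M} (h : f =ᶠ[𝓝 x] g) :
    tderiv I I' f x = tderiv I I' g x :=
  h.mfderiv_eq

lemma tderiv_id (x : M) : tderiv I I (fun y : M => y) x = ContinuousLinearMap.id ℝ F :=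
  mfderiv_id

lemma tderiv_eq_fderiv (f : F → F') (x : F) : tderiv 𝓘(ℝ, F) 𝓘(ℝ, F') f x = fderiv ℝ f x :=
  mfderiv_eq_fderiv

lemma tderiv_extChartAt_self [IsManifold I 1 M] (x : M) :
    tderiv I 𝓘(ℝ, F) (extChartAt I x) x = ContinuousLinearMap.id ℝ F :=
  mfderiv_extChartAt_self

variable [I.Boundaryless] [IsManifold I 1 M]

lemma mdifferentiableAt_extChartAt_symm' {x : M} {u : F} (hu : u ∈ (extChartAt I x).target) :
    MDifferentiableAt 𝓘(ℝ, F) I (extChartAt I x).symm u := by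
  have := mdifferentiableWithinAt_extChartAt_symm (I := I) hu
  rwa [I.range_eq_univ, mdifferentiableWithinAt_univ] at this

lemma tderiv_extChartAt_comp_symm {x : M} {u : F} (hu : u ∈ (extChartAt I x).target) :
    (tderiv I 𝓘(ℝ, F) (extChartAt I x) ((extChartAt I x).symm u)).comp
      (tderiv 𝓘(ℝ, F) I (extChartAt I x).symm u) = ContinuousLinearMap.id ℝ F := by
  have := mfderiv_extChartAt_comp_mfderivWithin_extChartAt_symm (I := I) hu
  rwa [I.range_eq_univ, mfderivWithin_univ] at this

lemma tderiv_extChartAt_symm_comp {x y : M} (hy : y ∈ (chartAt H x).source) :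
    (tderiv 𝓘(ℝ, F) I (extChartAt I x).symm (extChartAt I x y)).comp
      (tderiv I 𝓘(ℝ, F) (extChartAt I x) y) = ContinuousLinearMap.id ℝ F := by
  have := mfderivWithin_extChartAt_symm_comp_mfderiv_extChartAt' (I := I) (x := x) (y := y)
    (by rwa [extChartAt_source])
  rwa [I.range_eq_univ, mfderivWithin_univ] at this

lemma tderiv_extChartAt_symm_self (x : M) :
    tderiv 𝓘(ℝ, F) I (extChartAt I x).symm (extChartAt I x x) = ContinuousLinearMap.id ℝ F := by
  have := tderiv_extChartAt_symm_comp (I := I) (mem_chart_source H x)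
  rwa [tderiv_extChartAt_self, ContinuousLinearMap.comp_id] at this

end Derivative

/-! ### The canonical forms of `T*Q` in bundle charts. -/

section CotangentBundle

variable {E : Type*} [NormedAddCommGroup E] [NormedSpace ℝ E]
  {Q : Type*} [TopologicalSpace Q] [ChartedSpace E Q] [IsManifold 𝓘(ℝ, E) ∞ Q]

lemma canonicalOneForm_apply (β : CotangentBundle E Q) (v : E × (E →L[ℝ] ℝ)) :
    canonicalOneForm β v = (β.2 : E →L[ℝ] ℝ) v.1 := by
  unfold canonicalOneForm
  rw [mfderiv_totalSpace_proj]
  rfl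

lemma baseSet_cotangent (q : Q) :
    (trivializationAt (E →L[ℝ] ℝ) (fun q : Q => TangentSpace 𝓘(ℝ, E) q →L[ℝ] ℝ) q).baseSet =
      (chartAt E q).source := by
  rw [hom_trivializationAt_baseSet]
  simp

lemma mem_chart_cotangent_source {z β : CotangentBundle E Q} :
    β ∈ (chartAt (ModelProd E (E →L[ℝ] ℝ)) z).source ↔ β.1 ∈ (chartAt E z.1).source := by
  rw [← extChartAt_source (cotangentModel E), FiberBundle.extChartAt]
  simp only [PartialEquiv.trans_source, PartialEquiv.prod_source, PartialEquiv.refl_source,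
    mem_inter_iff, OpenPartialHomeomorph.toFun_eq_coe, mem_preimage, mem_prod, mem_univ, and_true,
    extChartAt_source, Trivialization.coe_coe]
  rw [Trivialization.mem_source, baseSet_cotangent]
  refine ⟨fun h => h.1, fun h => ⟨h, ?_⟩⟩
  rwa [Trivialization.coe_fst' _ (by rwa [baseSet_cotangent])]

lemma extChartAt_cotangent_snd (z β : CotangentBundle E Q) :
    (extChartAt (cotangentModel E) z β).2 = (β.2 : E →L[ℝ] ℝ).comp
      ((trivializationAt E (TangentSpace 𝓘(ℝ, E)) z.1).symmL ℝ β.1) := by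
  rw [extChartAt_totalSpace_snd]
  rw [hom_trivializationAt_apply]
  ext v
  simp [ContinuousLinearMap.inCoordinates]

lemma tderiv_extChartAt_cotangent_fst {z β : CotangentBundle E Q}
    (hβ : β.1 ∈ (chartAt E z.1).source) (v : E × (E →L[ℝ] ℝ)) :
    (tderiv (cotangentModel E) 𝓘(ℝ, E × (E →L[ℝ] ℝ)) (extChartAt (cotangentModel E) z) β v).1 =
      tderiv 𝓘(ℝ, E) 𝓘(ℝ, E) (extChartAt 𝓘(ℝ, E) z.1) β.1 v.1 := by
  have h1 : tderiv (cotangentModel E) 𝓘(ℝ, E)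
      (fun α : CotangentBundle E Q => (extChartAt (cotangentModel E) z α).1) β =
      tderiv (cotangentModel E) 𝓘(ℝ, E)
        (fun α : CotangentBundle E Q => extChartAt 𝓘(ℝ, E) z.1 α.1) β := by
    apply tderiv_congr
    have hc : Continuous (fun α : CotangentBundle E Q => α.1) := FiberBundle.continuous_proj _ _
    filter_upwards [hc.continuousAt.preimage_mem_nhds ((chartAt E z.1).open_source.mem_nhds hβ)]
      with α hα
    exact extChartAt_totalSpace_fst z α (by rwa [baseSet_cotangent])
  have h2 := tderiv_comp (I := cotangentModel E) (I' := 𝓘(ℝ, E × (E →L[ℝ] ℝ))) (I'' := 𝓘(ℝ, E))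
    (g := Prod.fst) (f := extChartAt (cotangentModel E) z) β
    (mdifferentiableAt_iff_differentiableAt.2 differentiableAt_fst)
    (mdifferentiableAt_extChartAt (mem_chart_cotangent_source.2 hβ))
  have h3 := tderiv_comp (I := cotangentModel E) (I' := 𝓘(ℝ, E)) (I'' := 𝓘(ℝ, E))
    (g := extChartAt 𝓘(ℝ, E) z.1) (f := fun α : CotangentBundle E Q => α.1) β
    (mdifferentiableAt_extChartAt hβ) (hasMFDerivAt_totalSpace_proj β).mdifferentiableAt
  rw [tderiv_eq_fderiv, fderiv_fst] at h2
  have h4 : tderiv (cotangentModel E) 𝓘(ℝ, E) (fun α : CotangentBundle E Q => α.1) β =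
    ContinuousLinearMap.fst ℝ _ _ := mfderiv_totalSpace_proj β
  rw [h4] at h3
  rw [h2, h3] at h1
  exact congrArg (fun L => L v) h1

/-- Bundle charts are Darboux charts: the fibre coordinate is the covector composed with the inverse
of the derivative of the base chart, and this cancels against the derivative applied to `v.1`. -/
lemma modelOneForm_extChartAt {z β : CotangentBundle E Q}
    (hβ : β.1 ∈ (chartAt E z.1).source) (v : E × (E →L[ℝ] ℝ)) :
    modelOneForm E (extChartAt (cotangentModel E) z β)
      (tderiv (cotangentModel E) 𝓘(ℝ, E × (E →L[ℝ] ℝ)) (extChartAt (cotangentModel E) z) β v) =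
      canonicalOneForm β v := by
  rw [modelOneForm_apply, extChartAt_cotangent_snd z β, tderiv_extChartAt_cotangent_fst hβ,
    canonicalOneForm_apply, tderiv]
  erw [← TangentBundle.continuousLinearMapAt_trivializationAt hβ]
  change (β.2 : E →L[ℝ] ℝ) _ = _
  congr 1
  exact Trivialization.symmL_continuousLinearMapAt (R := ℝ)
    (trivializationAt E (TangentSpace 𝓘(ℝ, E)) z.1) hβ v.1

lemma localOneForm_canonicalOneForm (z : CotangentBundle E Q) {u : E × (E →L[ℝ] ℝ)}
    (hu : u ∈ (extChartAt (cotangentModel E) z).target) :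
    localOneForm (cotangentModel E) canonicalOneForm z u = modelOneForm E u := by
  have hs : ((extChartAt (cotangentModel E) z).symm u).1 ∈ (chartAt E z.1).source := by
    rw [← mem_chart_cotangent_source, ← extChartAt_source (cotangentModel E)]
    exact (extChartAt (cotangentModel E) z).map_target hu
  refine ContinuousLinearMap.ext fun w => ?_
  change canonicalOneForm ((extChartAt (cotangentModel E) z).symm u)
    (tderiv 𝓘(ℝ, E × (E →L[ℝ] ℝ)) (cotangentModel E)
    (extChartAt (cotangentModel E) z).symm u w) = _
  rw [← modelOneForm_extChartAt hs, PartialEquiv.right_inv _ hu]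
  congr 1
  exact congrArg (fun L => L w) (tderiv_extChartAt_comp_symm hu)

/-- In the chart at `β` the canonical one-form is linear in the point, so its derivative is the same
linear map everywhere in the chart; the derivative of the chart at its centre is the identity. -/
lemma canonicalTwoForm_eq (β : CotangentBundle E Q) : canonicalTwoForm β = modelTwoForm E := by
  have hD : fderiv ℝ (localOneForm (cotangentModel E) (canonicalOneForm (Q := Q)) β)
      (extChartAt (cotangentModel E) β β) = modelOneForm E := by
    refine fderiv_eq_of_eventuallyEq_clm ?_
    filter_upwards [extChartAt_target_mem_nhds (I := cotangentModel E) β] with u hu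
    exact localOneForm_canonicalOneForm (Q := Q) β hu
  refine ContinuousLinearMap.ext fun (v : E × (E →L[ℝ] ℝ)) =>
    ContinuousLinearMap.ext fun (w : E × (E →L[ℝ] ℝ)) => ?_
  have h := extDerivOneForm_apply (I := cotangentModel E) (canonicalOneForm (Q := Q)) β v w
  rw [hD, tderiv_extChartAt_self] at h
  refine (congrArg Neg.neg h).trans ?_
  change -(modelOneForm E v w - modelOneForm E w v) = twoFormOf (modelOneForm E) v w
  rw [twoFormOf_apply]
  ring


/-- The Hamiltonian vector field, with values in the model space. -/
def hamiltonianVector (H : CotangentBundle E Q → ℝ) (β : CotangentBundle E Q) :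
    E × (E →L[ℝ] ℝ) := hamiltonianVectorField H β

/-- Hamilton's equation `i_{X_H} ω₀ = dH`. -/
lemma modelTwoForm_hamiltonianVector [FiniteDimensional ℝ E] (H : CotangentBundle E Q → ℝ)
    (β : CotangentBundle E Q)
    (w : E × (E →L[ℝ] ℝ)) :
    modelTwoForm E (hamiltonianVector H β) w = tderiv (cotangentModel E) 𝓘(ℝ, ℝ) H β w := by
  unfold hamiltonianVector hamiltonianVectorField
  rw [canonicalTwoForm_eq]
  exact congrArg (fun L => L w) (modelTwoForm_isInvertible.self_apply_inverse
    (tderiv (cotangentModel E) 𝓘(ℝ, ℝ) H β))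

end CotangentBundle

section

variable {W : Type*} [NormedAddCommGroup W] [NormedSpace ℝ W]

lemma contDiffAt_clm_fderiv {f : W → ℝ} {u : W} (hf : ContDiffAt ℝ ∞ f u)
    (L : (W →L[ℝ] ℝ) →L[ℝ] W) : ContDiffAt ℝ ∞ (fun x => L (fderiv ℝ f x)) u :=
  L.contDiff.contDiffAt.comp _ (hf.fderiv_right (m := ∞) (by simp))

end

/-! ### Maps that rescale the symplectic form, and smoothness of the Hamiltonian vector field. -/

section SymplecticMaps

variable {E : Type*} [NormedAddCommGroup E] [NormedSpace ℝ E]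
  {Q : Type*} [TopologicalSpace Q] [ChartedSpace E Q] [IsManifold 𝓘(ℝ, E) ∞ Q]

/-- A map to `E × E*` which pulls back the canonical one-form to `r θ₀` pulls back the canonical
symplectic form to `r ω₀`. -/
lemma modelTwoForm_tderiv {G : CotangentBundle E Q → E × (E →L[ℝ] ℝ)} {β : CotangentBundle E Q}
    {r : ℝ} (hG : ContMDiffAt (cotangentModel E) 𝓘(ℝ, E × (E →L[ℝ] ℝ)) ∞ G β)
    (h : ∀ᶠ α in 𝓝 β, ∀ w : E × (E →L[ℝ] ℝ), modelOneForm E (G α)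
      (tderiv (cotangentModel E) 𝓘(ℝ, E × (E →L[ℝ] ℝ)) G α w) = r * canonicalOneForm α w)
    (v w : E × (E →L[ℝ] ℝ)) :
    modelTwoForm E (tderiv (cotangentModel E) 𝓘(ℝ, E × (E →L[ℝ] ℝ)) G β v)
      (tderiv (cotangentModel E) 𝓘(ℝ, E × (E →L[ℝ] ℝ)) G β w) = r * modelTwoForm E v w := by
  set φ := extChartAt (cotangentModel E) β with hφ
  set F : E × (E →L[ℝ] ℝ) → E × (E →L[ℝ] ℝ) := fun u => G (φ.symm u) with hF
  have hφt : φ.target ∈ 𝓝 (φ β) := extChartAt_target_mem_nhds (I := cotangentModel E) β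
  have hsymm : Tendsto φ.symm (𝓝 (φ β)) (𝓝 β) := by
    have := continuousAt_extChartAt_symm (I := cotangentModel E) β
    rwa [ContinuousAt, extChartAt_to_inv] at this
  have hGe : ∀ᶠ α in 𝓝 β, MDifferentiableAt (cotangentModel E) 𝓘(ℝ, E × (E →L[ℝ] ℝ)) G α := by
    filter_upwards [(contMDiffAt_iff_contMDiffAt_nhds (n := 1) (by simp)).1
      (hG.of_le (by simp))] with α hα
    exact hα.mdifferentiableAt one_ne_zero
  have hFd : ∀ᶠ u in 𝓝 (φ β), fderiv ℝ F u =
      (tderiv (cotangentModel E) 𝓘(ℝ, E × (E →L[ℝ] ℝ)) G (φ.symm u)).comp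
        (tderiv 𝓘(ℝ, E × (E →L[ℝ] ℝ)) (cotangentModel E) φ.symm u) := by
    filter_upwards [hsymm.eventually hGe, hφt] with u hu hut
    rw [← tderiv_eq_fderiv]
    exact tderiv_comp u hu (mdifferentiableAt_extChartAt_symm' hut)
  have hFβ : fderiv ℝ F (φ β) = tderiv (cotangentModel E) 𝓘(ℝ, E × (E →L[ℝ] ℝ)) G β := by
    rw [hFd.self_of_nhds, tderiv_extChartAt_symm_self, ContinuousLinearMap.comp_id,
      extChartAt_to_inv]
  rw [← hFβ]
  refine twoFormOf_fderiv (modelOneForm E) ?_ ?_ v w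
  · have h1 : ContMDiffAt 𝓘(ℝ, E × (E →L[ℝ] ℝ)) (cotangentModel E) ∞ φ.symm (φ β) :=
      (contMDiffOn_extChartAt_symm β).contMDiffAt hφt
    have h2 : ContMDiffAt (cotangentModel E) 𝓘(ℝ, E × (E →L[ℝ] ℝ)) ∞ G (φ.symm (φ β)) := by
      rwa [extChartAt_to_inv]
    exact (h2.comp (φ β) h1).contDiffAt.of_le (by norm_cast)
  · filter_upwards [hFd, hφt, hsymm.eventually h] with u hu hut hh w
    rw [hu]
    refine (hh _).trans ?_
    rw [← localOneForm_canonicalOneForm β hut]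
    rfl

/-- Composing `f` with the chart at `f β` reduces to maps into `E × E*`: that chart carries the
canonical one-form to the model one and has identity derivative at `f β`. -/
lemma modelTwoForm_tderiv_self_map {f : CotangentBundle E Q → CotangentBundle E Q}
    {r : ℝ} (hf : ContMDiff (cotangentModel E) (cotangentModel E) ∞ f)
    (h : ∀ (α : CotangentBundle E Q) (w : E × (E →L[ℝ] ℝ)), canonicalOneForm (f α)
      (tderiv (cotangentModel E) (cotangentModel E) f α w) = r * canonicalOneForm α w)
    (β : CotangentBundle E Q) (v w : E × (E →L[ℝ] ℝ)) :
    modelTwoForm E (tderiv (cotangentModel E) (cotangentModel E) f β v)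
      (tderiv (cotangentModel E) (cotangentModel E) f β w) = r * modelTwoForm E v w := by
  set φ := extChartAt (cotangentModel E) (f β) with hφ
  have hmem : ∀ᶠ α in 𝓝 β, f α ∈ (chartAt (ModelProd E (E →L[ℝ] ℝ)) (f β)).source :=
    hf.continuous.continuousAt.preimage_mem_nhds
      ((chartAt (ModelProd E (E →L[ℝ] ℝ)) (f β)).open_source.mem_nhds (mem_chart_source _ _))
  have hd : ∀ᶠ α in 𝓝 β, tderiv (cotangentModel E) 𝓘(ℝ, E × (E →L[ℝ] ℝ)) (fun α => φ (f α)) α =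
      (tderiv (cotangentModel E) 𝓘(ℝ, E × (E →L[ℝ] ℝ)) φ (f α)).comp
        (tderiv (cotangentModel E) (cotangentModel E) f α) := by
    filter_upwards [hmem] with α hα
    exact tderiv_comp α (mdifferentiableAt_extChartAt hα) (hf.mdifferentiable (by simp) α)
  have hβ := hd.self_of_nhds
  rw [tderiv_extChartAt_self, ContinuousLinearMap.id_comp] at hβ
  rw [← hβ]
  refine modelTwoForm_tderiv ?_ ?_ v w
  · exact ContMDiffAt.comp β (contMDiffAt_extChartAt) (hf β)
  · filter_upwards [hd, hmem] with α hα hm w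
    rw [hα, ← h]
    exact modelOneForm_extChartAt (mem_chart_cotangent_source.1 hm) _

/-- Needed away from the centre of the chart as well, in order to write `X_H` in one chart on a
whole neighbourhood. -/
lemma modelTwoForm_tderiv_extChartAt (z : CotangentBundle E Q) {β : CotangentBundle E Q}
    (hβ : β ∈ (chartAt (ModelProd E (E →L[ℝ] ℝ)) z).source) (v w : E × (E →L[ℝ] ℝ)) :
    modelTwoForm E
      (tderiv (cotangentModel E) 𝓘(ℝ, E × (E →L[ℝ] ℝ)) (extChartAt (cotangentModel E) z) β v)
      (tderiv (cotangentModel E) 𝓘(ℝ, E × (E →L[ℝ] ℝ)) (extChartAt (cotangentModel E) z) β w) =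
      modelTwoForm E v w := by
  rw [modelTwoForm_tderiv (r := 1), one_mul]
  · exact contMDiffAt_extChartAt' hβ
  · filter_upwards [(chartAt (ModelProd E (E →L[ℝ] ℝ)) z).open_source.mem_nhds hβ] with α hα w
    rw [one_mul]
    exact modelOneForm_extChartAt (mem_chart_cotangent_source.1 hα) w

variable [FiniteDimensional ℝ E]

/-- The Hamiltonian vector field in a bundle chart. -/
lemma tderiv_extChartAt_hamiltonianVectorField {H : CotangentBundle E Q → ℝ}
    (hH : ContMDiff (cotangentModel E) 𝓘(ℝ, ℝ) ∞ H) (z : CotangentBundle E Q)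
    {β : CotangentBundle E Q} (hβ : β ∈ (chartAt (ModelProd E (E →L[ℝ] ℝ)) z).source) :
    tderiv (cotangentModel E) 𝓘(ℝ, E × (E →L[ℝ] ℝ)) (extChartAt (cotangentModel E) z) β
        (hamiltonianVector H β) =
      (modelTwoForm E).inverse (fderiv ℝ (fun u => H ((extChartAt (cotangentModel E) z).symm u))
        (extChartAt (cotangentModel E) z β)) := by
  set φ := extChartAt (cotangentModel E) z with hφ
  have hβs : β ∈ φ.source := by rwa [hφ, extChartAt_source]
  have hu : φ β ∈ φ.target := φ.map_source hβs
  have hd : fderiv ℝ (fun u => H (φ.symm u)) (φ β) =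
      (tderiv (cotangentModel E) 𝓘(ℝ, ℝ) H β).comp
        (tderiv 𝓘(ℝ, E × (E →L[ℝ] ℝ)) (cotangentModel E) φ.symm (φ β)) := by
    rw [← tderiv_eq_fderiv, tderiv_comp (I' := cotangentModel E) (φ β)
      (hH.mdifferentiable (by simp) _) (mdifferentiableAt_extChartAt_symm' hu), φ.left_inv hβs]
  symm
  rw [modelTwoForm_isInvertible.inverse_apply_eq, hd]
  refine ContinuousLinearMap.ext fun w => ?_
  have h1 := modelTwoForm_hamiltonianVector H β
    (tderiv 𝓘(ℝ, E × (E →L[ℝ] ℝ)) (cotangentModel E) φ.symm (φ β) w)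
  rw [← modelTwoForm_tderiv_extChartAt z hβ] at h1
  refine h1.symm.trans ?_
  congr 1
  have := congrArg (fun L => L w) (tderiv_extChartAt_comp_symm (I := cotangentModel E) hu)
  rwa [φ.left_inv hβs] at this

/-- In a bundle chart `X_H` is a constant linear map applied to the differential of the coordinate
expression of `H`. -/
lemma contMDiff_hamiltonianVectorField {H : CotangentBundle E Q → ℝ}
    (hH : ContMDiff (cotangentModel E) 𝓘(ℝ, ℝ) ∞ H) :
    ContMDiff (cotangentModel E) (cotangentModel E).tangent ∞
      (fun β => (⟨β, hamiltonianVectorField H β⟩ :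
        TangentBundle (cotangentModel E) (CotangentBundle E Q))) := by
  intro z
  rw [contMDiffAt_section]
  set φ := extChartAt (cotangentModel E) z with hφ
  have hu : φ.target ∈ 𝓝 (φ z) := extChartAt_target_mem_nhds (I := cotangentModel E) z
  have h1 : ContMDiffAt 𝓘(ℝ, E × (E →L[ℝ] ℝ)) (cotangentModel E) ∞ φ.symm (φ z) :=
    (contMDiffOn_extChartAt_symm z).contMDiffAt hu
  have h2 : ContDiffAt ℝ ∞ (fun u => H (φ.symm u)) (φ z) :=
    ((hH _).comp (φ z) h1).contDiffAt
  have h3 : ContDiffAt ℝ ∞ (fun u => (modelTwoForm E).inverse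
      (fderiv ℝ (fun u => H (φ.symm u)) u)) (φ z) :=
    contDiffAt_clm_fderiv h2 _
  refine (h3.contMDiffAt.comp z (contMDiffAt_extChartAt (n := ∞))).congr_of_eventuallyEq ?_
  filter_upwards [chart_source_mem_nhds (ModelProd E (E →L[ℝ] ℝ)) z] with β hβ
  refine Eq.trans ?_ (tderiv_extChartAt_hamiltonianVectorField hH z hβ)
  have h4 := TangentBundle.continuousLinearMapAt_trivializationAt (I := cotangentModel E) hβ
  have h5 := congrArg (fun L => L (hamiltonianVector H β)) h4
  refine Eq.trans ?_ h5
  exact (congrFun (Trivialization.coe_linearMapAt_of_mem (R := ℝ) _ (by simpa using hβ)) _).symm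

end SymplecticMaps

/-! ### Hausdorff total spaces and maximal integral curves. -/

section Hausdorff

variable {B F : Type*} {V : B → Type*} [TopologicalSpace B] [TopologicalSpace F]
  [TopologicalSpace (TotalSpace F V)] [∀ x, TopologicalSpace (V x)] [FiberBundle F V]

/-- Uniqueness of integral curves on `T*Q` needs this. Points over the same base point are separated
in a trivialization, the others by their projections. -/
lemma t2Space_totalSpace [T2Space B] [T2Space F] : T2Space (TotalSpace F V) := by
  refine ⟨fun x y hxy => ?_⟩
  by_cases h : x.1 = y.1
  · set e := trivializationAt F V x.1
    have hx : x ∈ e.source := FiberBundle.mem_trivializationAt_proj_source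
    have hy : y ∈ e.source := by
      rw [e.mem_source, ← h]
      exact FiberBundle.mem_baseSet_trivializationAt' x.1
    have hne : e x ≠ e y := fun h' => hxy (e.injOn hx hy h')
    obtain ⟨u, v, hu, hv, hxu, hyv, huv⟩ := t2_separation hne
    refine ⟨e.source ∩ e ⁻¹' u, e.source ∩ e ⁻¹' v,
      e.continuousOn.isOpen_inter_preimage e.open_source hu,
      e.continuousOn.isOpen_inter_preimage e.open_source hv, ⟨hx, hxu⟩, ⟨hy, hyv⟩, ?_⟩
    exact (huv.preimage e).mono inter_subset_right inter_subset_right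
  · obtain ⟨u, v, hu, hv, hxu, hyv, huv⟩ := t2_separation h
    have hc : Continuous (fun x : TotalSpace F V => x.1) := FiberBundle.continuous_proj F V
    exact ⟨_, _, hu.preimage hc, hv.preimage hc, hxu, hyv, huv.preimage _⟩

end Hausdorff

section MaximalIntegralCurves

variable {F : Type*} [NormedAddCommGroup F] [NormedSpace ℝ F]
  {H : Type*} [TopologicalSpace H] {J : ModelWithCorners ℝ F H} {M : Type*} [TopologicalSpace M]
  [ChartedSpace H M]

/-- Brings arbitrary open order-connected domains into the form `Ioo a b` required by the uniqueness
theorem for integral curves. -/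
lemma exists_Ioo_of_isOpen_ordConnected {S : Set ℝ} (hS : IsOpen S) (hc : S.OrdConnected)
    {s t : ℝ} (hs : s ∈ S) (ht : t ∈ S) : ∃ a b, s ∈ Ioo a b ∧ t ∈ Ioo a b ∧ Ioo a b ⊆ S := by
  wlog hst : s ≤ t generalizing s t
  · obtain ⟨a, b, h1, h2, h3⟩ := this ht hs (le_of_not_ge hst)
    exact ⟨a, b, h2, h1, h3⟩
  obtain ⟨a, b, hab, h⟩ := mem_nhds_iff_exists_Ioo_subset.1 (hS.mem_nhds hs)
  obtain ⟨a', b', hab', h'⟩ := mem_nhds_iff_exists_Ioo_subset.1 (hS.mem_nhds ht)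
  refine ⟨a, b', ⟨hab.1, hst.trans_lt hab'.2⟩, ⟨hab.1.trans_le hst, hab'.2⟩, fun x hx => ?_⟩
  rcases lt_or_ge x s with hxs | hxs
  · exact h ⟨hx.1, hxs.trans hab.2⟩
  rcases le_or_gt x t with hxt | hxt
  · exact hc.out hs ht ⟨hxs, hxt⟩
  · exact h' ⟨hab'.1.trans hxt, hx.2⟩

variable [IsManifold J 1 M] [BoundarylessManifold J M] [T2Space M]
  {X : ∀ x : M, TangentSpace J x} {z : M}

lemma IsIntegralCurveFrom.eqOn
    (hX : ContMDiff J J.tangent 1 (fun x => (⟨x, X x⟩ : TangentBundle J M)))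
    {γ δ : ℝ → M} {S T : Set ℝ}
    (hγ : IsIntegralCurveFrom X z γ S) (hδ : IsIntegralCurveFrom X z δ T) :
    EqOn γ δ (S ∩ T) := by
  intro t ht
  obtain ⟨a, b, h0, h1, h⟩ := exists_Ioo_of_isOpen_ordConnected (hγ.isOpen.inter hδ.isOpen)
    (hγ.ordConnected.inter hδ.ordConnected) ⟨hγ.zero_mem, hδ.zero_mem⟩ ht
  exact isMIntegralCurveOn_Ioo_eqOn_of_contMDiff_boundaryless h0 hX
    (hγ.integral.mono (h.trans inter_subset_left)) (hδ.integral.mono (h.trans inter_subset_right))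
    (hγ.initial.trans hδ.initial.symm) h1

/-- The domain is the union of the domains of all integral curves from `z`. These agree on overlaps
by uniqueness, so choosing any one of them at each time defines a curve which is locally an integral
curve. -/
lemma exists_isMaximalIntegralCurve [CompleteSpace F]
    (hX : ContMDiff J J.tangent 1 (fun x => (⟨x, X x⟩ : TangentBundle J M))) (z : M) :
    ∃ (γ : ℝ → M) (S : Set ℝ), IsMaximalIntegralCurve X z γ S := by
  classical
  let P : ℝ → (ℝ → M) → Set ℝ → Prop := fun t δ T => IsIntegralCurveFrom X z δ T ∧ t ∈ T
  let S : Set ℝ := {t | ∃ δ T, P t δ T}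
  let γ : ℝ → M := fun t => if h : t ∈ S then h.choose t else z
  have hγ : ∀ {δ T}, IsIntegralCurveFrom X z δ T → T ⊆ S ∧ EqOn δ γ T := by
    intro δ T hδ
    have hsub : T ⊆ S := fun t ht => ⟨δ, T, hδ, ht⟩
    refine ⟨hsub, fun t ht => ?_⟩
    have hS : t ∈ S := hsub ht
    simp only [γ, dif_pos hS]
    obtain ⟨T', h', ht'⟩ := hS.choose_spec
    exact hδ.eqOn hX h' ⟨ht, ht'⟩
  obtain ⟨γ₀, hγ₀, hi⟩ := exists_isMIntegralCurveAt_of_contMDiffAt_boundaryless 0 (hX z)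
  obtain ⟨ε, hε, hi⟩ := isMIntegralCurveAt_iff'.1 hi
  have h₀ : IsIntegralCurveFrom X z γ₀ (Metric.ball 0 ε) :=
    ⟨Metric.isOpen_ball, (convex_ball 0 ε).ordConnected, Metric.mem_ball_self hε, hγ₀, hi⟩
  refine ⟨γ, S, ⟨⟨?_, ?_, ?_, ?_, ?_⟩, fun δ T hδ => hγ hδ⟩⟩
  · refine isOpen_iff_mem_nhds.2 ?_
    rintro t ⟨δ, T, hδ, ht⟩
    exact mem_of_superset (hδ.isOpen.mem_nhds ht) (hγ hδ).1
  · have hun : S = ⋃₀ {T | ∃ δ, IsIntegralCurveFrom X z δ T} := by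
      ext t
      constructor
      · rintro ⟨δ, T, hδ, ht⟩
        exact ⟨T, ⟨δ, hδ⟩, ht⟩
      · rintro ⟨T, ⟨δ, hδ⟩, ht⟩
        exact ⟨δ, T, hδ, ht⟩
    rw [hun, ← isPreconnected_iff_ordConnected]
    refine isPreconnected_sUnion 0 _ ?_ ?_
    · rintro T ⟨δ, hδ⟩
      exact hδ.zero_mem
    · rintro T ⟨δ, hδ⟩
      exact hδ.ordConnected.isPreconnected
  · exact (hγ h₀).1 h₀.zero_mem
  · rw [← (hγ h₀).2 h₀.zero_mem, hγ₀]
  · rintro t ⟨δ, T, hδ, ht⟩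
    have h1 := (hδ.integral t ht).hasMFDerivAt (hδ.isOpen.mem_nhds ht)
    have he : γ =ᶠ[𝓝 t] δ := by
      filter_upwards [hδ.isOpen.mem_nhds ht] with s hs
      exact ((hγ hδ).2 hs).symm
    have h2 := h1.congr_of_eventuallyEq he
    rw [← he.self_of_nhds] at h2
    exact h2.hasMFDerivWithinAt

end MaximalIntegralCurves

/-! ### Flows and their generators in charts. -/

section Flow

variable {F H N : Type*} [NormedAddCommGroup F] [NormedSpace ℝ F] [TopologicalSpace H]
  {I : ModelWithCorners ℝ F H} [TopologicalSpace N] [ChartedSpace H N] {ψ : ℝ → N → N}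

lemma contMDiff_flow_left
    (hψ : ContMDiff (𝓘(ℝ, ℝ).prod I) I ∞ (fun p : ℝ × N => ψ p.1 p.2)) (x : N) :
    ContMDiff 𝓘(ℝ, ℝ) I ∞ (fun τ => ψ τ x) :=
  hψ.comp (contMDiff_id.prodMk contMDiff_const)

/-- A flow near time `0` in the chart at `x₀`. -/
def flowInChart (I : ModelWithCorners ℝ F H) (ψ : ℝ → N → N) (x₀ : N) (p : ℝ × F) : F :=
  extChartAt I x₀ (ψ p.1 ((extChartAt I x₀).symm p.2))

lemma flowInChart_apply (ψ : ℝ → N → N) {x₀ x : N} (hx : x ∈ (chartAt H x₀).source) (τ : ℝ) :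
    flowInChart I ψ x₀ (τ, extChartAt I x₀ x) = extChartAt I x₀ (ψ τ x) := by
  simp only [flowInChart]
  rw [(extChartAt I x₀).left_inv (by rwa [extChartAt_source])]

lemma flowInChart_zero (h0 : ∀ x, ψ 0 x = x) (x₀ : N) {u : F} (hu : u ∈ (extChartAt I x₀).target) :
    flowInChart I ψ x₀ (0, u) = u := by
  simp only [flowInChart]
  rw [h0, (extChartAt I x₀).right_inv hu]

lemma tderiv_extChartAt_eq_trivializationAt [IsManifold I 1 N] {x₀ x : N}
    (hx : x ∈ (chartAt H x₀).source) (v : F) :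
    (trivializationAt F (TangentSpace I) x₀ (⟨x, v⟩ : TangentBundle I N)).2 =
      tderiv I 𝓘(ℝ, F) (extChartAt I x₀) x v := by
  have h4 := TangentBundle.continuousLinearMapAt_trivializationAt (I := I) hx
  have h5 := congrArg (fun L => L v) h4
  refine Eq.trans ?_ h5
  exact (congrFun (Trivialization.coe_linearMapAt_of_mem (R := ℝ) _ (by simpa using hx)) _).symm

variable [I.Boundaryless] [IsManifold I ∞ N]

lemma contDiffAt_flowInChart
    (hψ : ContMDiff (𝓘(ℝ, ℝ).prod I) I ∞ (fun p : ℝ × N => ψ p.1 p.2)) (h0 : ∀ x, ψ 0 x = x)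
    (x₀ : N) {u : F} (hu : u ∈ (extChartAt I x₀).target) :
    ContDiffAt ℝ ∞ (flowInChart I ψ x₀) (0, u) := by
  have h1 : ContMDiffAt 𝓘(ℝ, F) I ∞ (extChartAt I x₀).symm u :=
    (contMDiffOn_extChartAt_symm x₀).contMDiffAt ((isOpen_extChartAt_target x₀).mem_nhds hu)
  have hm : (extChartAt I x₀).symm u ∈ (chartAt H x₀).source := by
    rw [← extChartAt_source I]; exact (extChartAt I x₀).map_target hu
  have h2 : ContMDiffAt (𝓘(ℝ, ℝ).prod 𝓘(ℝ, F)) (𝓘(ℝ, ℝ).prod I) ∞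
      (fun p : ℝ × F => (p.1, (extChartAt I x₀).symm p.2)) (0, u) :=
    contMDiffAt_fst.prodMk (ContMDiffAt.comp (0, u) h1 contMDiffAt_snd)
  have h3 : ContMDiffAt I 𝓘(ℝ, F) ∞ (extChartAt I x₀) (ψ 0 ((extChartAt I x₀).symm u)) := by
    rw [h0]; exact contMDiffAt_extChartAt' hm
  have h4 : ContMDiffAt (𝓘(ℝ, ℝ).prod 𝓘(ℝ, F)) 𝓘(ℝ, F) ∞ (flowInChart I ψ x₀) (0, u) :=
    ContMDiffAt.comp (0, u) h3 (ContMDiffAt.comp (0, u) (hψ _) h2)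
  rw [← modelWithCornersSelf_prod, chartedSpaceSelf_prod] at h4
  exact h4.contDiffAt

/-- The generator of a flow, with values in the model space. -/
def flowGenerator (I : ModelWithCorners ℝ F H) (ψ : ℝ → N → N) (x : N) : F :=
  tderiv 𝓘(ℝ, ℝ) I (fun τ => ψ τ x) 0 1

lemma tderiv_extChartAt_flowGenerator
    (hψ : ContMDiff (𝓘(ℝ, ℝ).prod I) I ∞ (fun p : ℝ × N => ψ p.1 p.2)) (h0 : ∀ x, ψ 0 x = x)
    {x₀ x : N} (hx : x ∈ (chartAt H x₀).source) :
    tderiv I 𝓘(ℝ, F) (extChartAt I x₀) x (flowGenerator I ψ x) =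
      fderiv ℝ (flowInChart I ψ x₀) (0, extChartAt I x₀ x) (1, 0) := by
  have : IsManifold I 1 N := IsManifold.of_le (n := ∞) (by simp)
  have hu : extChartAt I x₀ x ∈ (extChartAt I x₀).target :=
    (extChartAt I x₀).map_source (by rwa [extChartAt_source])
  have h1 := tderiv_comp (I := 𝓘(ℝ, ℝ)) (I' := I) (I'' := 𝓘(ℝ, F)) (g := extChartAt I x₀)
    (f := fun τ => ψ τ x) 0 (by rw [h0]; exact mdifferentiableAt_extChartAt hx)
    ((contMDiff_flow_left hψ x).mdifferentiable (by simp) 0)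
  rw [h0] at h1
  have h2 : HasFDerivAt (fun τ : ℝ => extChartAt I x₀ (ψ τ x))
      ((fderiv ℝ (flowInChart I ψ x₀) (0, extChartAt I x₀ x)).comp
        (ContinuousLinearMap.inl ℝ ℝ F)) 0 := by
    have h3 := ((contDiffAt_flowInChart hψ h0 x₀ hu).differentiableAt (by simp)).hasFDerivAt
    have h4 : HasFDerivAt (fun τ : ℝ => (τ, extChartAt I x₀ x))
      (ContinuousLinearMap.inl ℝ ℝ F) 0 := hasFDerivAt_prodMk_left 0 _
    refine (HasFDerivAt.comp (0 : ℝ) h3 h4).congr_of_eventuallyEq (Eventually.of_forall fun τ => ?_)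
    exact (flowInChart_apply ψ hx τ).symm
  rw [tderiv_eq_fderiv, h2.fderiv] at h1
  exact (congrArg (fun L => L 1) h1).symm

/-- In coordinates the generator is the partial time derivative at time `0` of the smooth map
`flowInChart`. -/
lemma contMDiffAt_tderiv_extChartAt_flowGenerator
    (hψ : ContMDiff (𝓘(ℝ, ℝ).prod I) I ∞ (fun p : ℝ × N => ψ p.1 p.2)) (h0 : ∀ x, ψ 0 x = x)
    (x₀ : N) : ContMDiffAt I 𝓘(ℝ, F) ∞
      (fun x => tderiv I 𝓘(ℝ, F) (extChartAt I x₀) x (flowGenerator I ψ x)) x₀ := by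
  have h1 : ContDiffAt ℝ ∞ (fun u => fderiv ℝ (flowInChart I ψ x₀) (0, u) (1, 0))
      (extChartAt I x₀ x₀) := by
    have h2 := contDiffAt_flowInChart hψ h0 x₀ (mem_extChartAt_target (I := I) x₀)
    have h3 := (h2.fderiv_right (m := ∞) (by simp)).clm_apply
      (contDiffAt_const (c := ((1 : ℝ), (0 : F))))
    exact ContDiffAt.comp (extChartAt I x₀ x₀) h3 (contDiffAt_const.prodMk contDiffAt_id)
  refine (h1.contMDiffAt.comp x₀ (contMDiffAt_extChartAt (n := ∞))).congr_of_eventuallyEq ?_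
  filter_upwards [chart_source_mem_nhds H x₀] with x hx
  exact tderiv_extChartAt_flowGenerator hψ h0 hx

end Flow

/-! ### The metric, the Hamiltonian and the Legendre transformation. -/

section Mechanics

variable {E : Type*} [NormedAddCommGroup E] [NormedSpace ℝ E]
  {Q : Type*} [TopologicalSpace Q] [ChartedSpace E Q] [IsManifold 𝓘(ℝ, E) ∞ Q]

/-- The Riemannian metric at `q`, as a bilinear form on the model space. -/
def metricAt (m : Metric E Q) (q : Q) : E →L[ℝ] E →L[ℝ] ℝ := m.inner q

lemma metricAt_symm (m : Metric E Q) (q : Q) (v w : E) : metricAt m q v w = metricAt m q w v :=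
  m.symm q v w

lemma metricAt_pos (m : Metric E Q) (q : Q) {v : E} (hv : v ≠ 0) : 0 < metricAt m q v v :=
  m.pos q v hv

lemma metricAt_nonneg (m : Metric E Q) (q : Q) (v : E) : 0 ≤ metricAt m q v v := by
  by_cases hv : v = 0
  · simp [hv]
  · exact (metricAt_pos m q hv).le

lemma metricAt_isInvertible [FiniteDimensional ℝ E] (m : Metric E Q) (q : Q) :
    (metricAt m q).IsInvertible := by
  refine isInvertible_of_injective_toDual ((injective_iff_map_eq_zero _).2 fun v hv => ?_)
  by_contra hne
  have := metricAt_pos m q hne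
  rw [hv] at this
  exact lt_irrefl _ this

/-- The inverse of the metric, as a map from covectors to vectors. -/
def sharp (m : Metric E Q) (q : Q) : (E →L[ℝ] ℝ) →L[ℝ] E := (metricAt m q).inverse

lemma metricAt_sharp [FiniteDimensional ℝ E] (m : Metric E Q) (q : Q) (p : E →L[ℝ] ℝ) :
    metricAt m q (sharp m q p) = p :=
  (metricAt_isInvertible m q).self_apply_inverse p

lemma sharp_eq_iff [FiniteDimensional ℝ E] (m : Metric E Q) (q : Q) (p : E →L[ℝ] ℝ) (v : E) :
    sharp m q p = v ↔ p = metricAt m q v :=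
  (metricAt_isInvertible m q).inverse_apply_eq

/-- The covector part of a point of `T*Q`. -/
def momentum (β : CotangentBundle E Q) : E →L[ℝ] ℝ := β.2

lemma hamiltonian_eq [FiniteDimensional ℝ E] (m : Metric E Q) (U : Q → ℝ)
    (β : CotangentBundle E Q) :
    hamiltonian m U β = 1 / 2 * momentum β (sharp m β.1 (momentum β)) + U β.1 := by
  change 1 / 2 * metricAt m β.1 (sharp m β.1 (momentum β)) (sharp m β.1 (momentum β)) + U β.1 = _
  rw [metricAt_sharp]

/-- The chart at `q₀` identifies `E` with the tangent space at `q`. -/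
def fromChart (q₀ q : Q) : E →L[ℝ] E :=
  (trivializationAt E (TangentSpace 𝓘(ℝ, E)) q₀).symmL ℝ q

lemma fromChart_tderiv {q₀ q : Q} (hq : q ∈ (chartAt E q₀).source) (v : E) :
    fromChart q₀ q (tderiv 𝓘(ℝ, E) 𝓘(ℝ, E) (extChartAt 𝓘(ℝ, E) q₀) q v) = v := by
  unfold tderiv
  erw [← TangentBundle.continuousLinearMapAt_trivializationAt hq]
  exact Trivialization.symmL_continuousLinearMapAt (R := ℝ)
    (trivializationAt E (TangentSpace 𝓘(ℝ, E)) q₀) hq v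

lemma tderiv_fromChart {q₀ q : Q} (hq : q ∈ (chartAt E q₀).source) (v : E) :
    tderiv 𝓘(ℝ, E) 𝓘(ℝ, E) (extChartAt 𝓘(ℝ, E) q₀) q (fromChart q₀ q v) = v := by
  unfold tderiv
  erw [← TangentBundle.continuousLinearMapAt_trivializationAt hq]
  exact Trivialization.continuousLinearMapAt_symmL (R := ℝ)
    (trivializationAt E (TangentSpace 𝓘(ℝ, E)) q₀) hq v

/-- The metric in the chart at `q₀`. -/
def metricInChart (m : Metric E Q) (q₀ q : Q) : E →L[ℝ] E →L[ℝ] ℝ :=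
  ContinuousLinearMap.inCoordinates E (TangentSpace 𝓘(ℝ, E)) (E →L[ℝ] ℝ)
    (fun q : Q => TangentSpace 𝓘(ℝ, E) q →L[ℝ] ℝ) q₀ q q₀ q (m.inner q)

lemma contMDiffAt_metricInChart (m : Metric E Q) (q₀ : Q) :
    ContMDiffAt 𝓘(ℝ, E) 𝓘(ℝ, E →L[ℝ] E →L[ℝ] ℝ) ∞ (metricInChart m q₀) q₀ :=
  ((contMDiffAt_hom_bundle _).1 (m.contMDiff q₀)).2

lemma metricInChart_apply (m : Metric E Q) {q₀ q : Q} (hq : q ∈ (chartAt E q₀).source) (v w : E) :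
    metricInChart m q₀ q v w = metricAt m q (fromChart q₀ q v) (fromChart q₀ q w) := by
  let p : E →L[ℝ] ℝ := metricAt m q (fromChart q₀ q v)
  have h1 := congrFun (Trivialization.coe_linearMapAt_of_mem (R := ℝ)
    (trivializationAt (E →L[ℝ] ℝ) (fun q : Q => TangentSpace 𝓘(ℝ, E) q →L[ℝ] ℝ) q₀)
    (by rwa [baseSet_cotangent] : q ∈ _)) p
  -- The coordinate formula for covectors is reused for `p`; the chart depends only on the base
  -- point `q₀`, so the covector `0` over it is a dummy.
  have h2 := extChartAt_cotangent_snd (E := E) (Q := Q) ⟨q₀, 0⟩ ⟨q, p⟩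
  rw [extChartAt_totalSpace_snd] at h2
  exact congrArg (fun L : E →L[ℝ] ℝ => L w) (h1.trans h2)

lemma metricInChart_isInvertible [FiniteDimensional ℝ E] (m : Metric E Q) {q₀ q : Q}
    (hq : q ∈ (chartAt E q₀).source) : (metricInChart m q₀ q).IsInvertible := by
  refine isInvertible_of_injective_toDual ((injective_iff_map_eq_zero _).2 fun v hv => ?_)
  have h1 := metricInChart_apply m hq v v
  rw [hv] at h1
  have h2 : fromChart q₀ q v = 0 := by
    by_contra hne
    exact (metricAt_pos m q hne).ne h1
  rw [← tderiv_fromChart hq v, h2, map_zero]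

lemma extChartAt_cotangent_snd_apply (z β : CotangentBundle E Q) (v : E) :
    (extChartAt (cotangentModel E) z β).2 v = momentum β (fromChart z.1 β.1 v) :=
  congrArg (fun L : E →L[ℝ] ℝ => L v) (extChartAt_cotangent_snd z β)

lemma momentum_apply_eq_chart {z β : CotangentBundle E Q} (hβ : β.1 ∈ (chartAt E z.1).source)
    (v : E) : momentum β v = (extChartAt (cotangentModel E) z β).2
      (tderiv 𝓘(ℝ, E) 𝓘(ℝ, E) (extChartAt 𝓘(ℝ, E) z.1) β.1 v) := by
  rw [extChartAt_cotangent_snd_apply, fromChart_tderiv hβ]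

lemma metricAt_eq_chart (m : Metric E Q) {q₀ q : Q} (hq : q ∈ (chartAt E q₀).source) (v w : E) :
    metricAt m q v w = metricInChart m q₀ q
      (tderiv 𝓘(ℝ, E) 𝓘(ℝ, E) (extChartAt 𝓘(ℝ, E) q₀) q v)
      (tderiv 𝓘(ℝ, E) 𝓘(ℝ, E) (extChartAt 𝓘(ℝ, E) q₀) q w) := by
  rw [metricInChart_apply m hq, fromChart_tderiv hq, fromChart_tderiv hq]

lemma sharp_momentum_eq_chart [FiniteDimensional ℝ E] (m : Metric E Q) {z β : CotangentBundle E Q}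
    (hβ : β.1 ∈ (chartAt E z.1).source) :
    sharp m β.1 (momentum β) = fromChart z.1 β.1
      ((metricInChart m z.1 β.1).inverse (extChartAt (cotangentModel E) z β).2) := by
  rw [sharp_eq_iff]
  refine ContinuousLinearMap.ext fun w => ?_
  rw [metricAt_eq_chart m hβ, tderiv_fromChart hβ,
    (metricInChart_isInvertible m hβ).self_apply_inverse, momentum_apply_eq_chart hβ]

lemma contMDiff_cotangent_proj :
    ContMDiff (cotangentModel E) 𝓘(ℝ, E) ∞ (fun β : CotangentBundle E Q => β.1) :=
  contMDiff_proj _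

lemma eventually_mem_chart_cotangent (z : CotangentBundle E Q) :
    ∀ᶠ β : CotangentBundle E Q in 𝓝 z, β.1 ∈ (chartAt E z.1).source :=
  mem_of_superset (chart_source_mem_nhds (ModelProd E (E →L[ℝ] ℝ)) z) fun _ =>
    mem_chart_cotangent_source.1

lemma contMDiffAt_extChartAt_cotangent_snd (z : CotangentBundle E Q) :
    ContMDiffAt (cotangentModel E) 𝓘(ℝ, E →L[ℝ] ℝ) ∞
      (fun β => (extChartAt (cotangentModel E) z β).2) z :=
  contDiff_snd.contMDiff.contMDiffAt.comp z
    (contMDiffAt_extChartAt (I := cotangentModel E) (n := ∞) (x := z))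

/-- In a bundle chart `H = ½ p G⁻¹ p + U` with `G` the matrix of the metric, and inversion is smooth
at invertible operators. -/
lemma contMDiff_hamiltonian [FiniteDimensional ℝ E] (m : Metric E Q) {U : Q → ℝ}
    (hU : ContMDiff 𝓘(ℝ, E) 𝓘(ℝ, ℝ) ∞ U) :
    ContMDiff (cotangentModel E) 𝓘(ℝ, ℝ) ∞ (hamiltonian m U) := by
  intro z
  have hG : ContMDiffAt (cotangentModel E) 𝓘(ℝ, E →L[ℝ] E →L[ℝ] ℝ) ∞
      (fun β : CotangentBundle E Q => metricInChart m z.1 β.1) z :=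
    ContMDiffAt.comp z (contMDiffAt_metricInChart m z.1) (contMDiff_cotangent_proj z)
  have hi : ContMDiffAt (cotangentModel E) 𝓘(ℝ, (E →L[ℝ] ℝ) →L[ℝ] E) ∞
      (fun β : CotangentBundle E Q => (metricInChart m z.1 β.1).inverse) z := by
    have : CompleteSpace E := FiniteDimensional.complete ℝ E
    have h := metricInChart_isInvertible m (mem_chart_source E z.1)
    exact h.contDiffAt_map_inverse.contMDiffAt.comp z hG
  have hp := contMDiffAt_extChartAt_cotangent_snd z
  have h1 : ContMDiffAt (cotangentModel E) 𝓘(ℝ, ℝ) ∞ (fun β : CotangentBundle E Q =>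
      1 / 2 * (extChartAt (cotangentModel E) z β).2 ((metricInChart m z.1 β.1).inverse
        (extChartAt (cotangentModel E) z β).2) + U β.1) z :=
    (contMDiffAt_const.mul (hp.clm_apply (hi.clm_apply hp))).add
      ((hU _).comp z (contMDiff_cotangent_proj z))
  refine h1.congr_of_eventuallyEq ?_
  filter_upwards [eventually_mem_chart_cotangent z] with β hβ
  rw [hamiltonian_eq, extChartAt_cotangent_snd_apply, sharp_momentum_eq_chart m hβ]

lemma contMDiff_legendre (m : Metric E Q) :
    ContMDiff 𝓘(ℝ, E).tangent (cotangentModel E) ∞ (legendre m) := by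
  intro v
  have h1 := (m.contMDiff v.1).comp v (contMDiffAt_proj (n := ∞) (IB := 𝓘(ℝ, E))
    (TangentSpace 𝓘(ℝ, E) : Q → Type _))
  exact ContMDiffAt.clm_bundle_apply h1 contMDiffAt_id

/-- The Legendre transformation covers the identity of `Q`, so `θ_L` only sees the projection of `w`
to `Q`. -/
lemma lagrangianOneForm_apply (m : Metric E Q) (v : TangentBundle 𝓘(ℝ, E) Q) (w : E × E) :
    lagrangianOneForm m v w = metricAt m v.1 v.2 w.1 := by
  change canonicalOneForm (legendre m v)
    (tderiv 𝓘(ℝ, E).tangent (cotangentModel E) (legendre m) v w) = _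
  rw [canonicalOneForm_apply]
  have h1 := tderiv_comp (I := 𝓘(ℝ, E).tangent) (I' := cotangentModel E) (I'' := 𝓘(ℝ, E))
    (g := fun α : CotangentBundle E Q => α.1) (f := legendre m) v
    (hasMFDerivAt_totalSpace_proj _).mdifferentiableAt
    ((contMDiff_legendre m).mdifferentiable (by simp) v)
  have h2 : tderiv (cotangentModel E) 𝓘(ℝ, E) (fun α : CotangentBundle E Q => α.1)
      (legendre m v) = ContinuousLinearMap.fst ℝ _ _ := mfderiv_totalSpace_proj _
  have h3 : tderiv 𝓘(ℝ, E).tangent 𝓘(ℝ, E) (fun u : TangentBundle 𝓘(ℝ, E) Q => u.1) v =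
      ContinuousLinearMap.fst ℝ _ _ := mfderiv_totalSpace_proj _
  rw [h2] at h1
  have h4 := congrArg (fun L => L w) (h1.symm.trans h3)
  exact congrArg (metricAt m v.1 v.2) h4

/-- Both terms factor through the projection to `Q`, whose derivative is onto; the equation on
`T(TQ)` is therefore one of covectors on `Q`. -/
lemma centralConfigurationEquation_iff (m : Metric E Q) (U : Q → ℝ) (Ψ : ScalingAction E Q)
    (c ξ : ℝ) (q : Q) : CentralConfigurationEquation m U Ψ c ξ q ↔
      ∀ w : E, tderiv 𝓘(ℝ, E) 𝓘(ℝ, ℝ) (augmentedPotential m U Ψ ξ) q w +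
        c * ξ * metricAt m q (Ψ.generator ξ q) w = 0 := by
  have key (w : E × E) : (mfderiv 𝓘(ℝ, E).tangent 𝓘(ℝ, E)
      (fun u : TangentBundle 𝓘(ℝ, E) Q => u.1) ⟨q, Ψ.generator ξ q⟩ : E × E →L[ℝ] E) w = w.1 := by
    rw [mfderiv_totalSpace_proj]
    rfl
  constructor
  · intro h w
    have h1 := h ((w, 0) : E × E)
    erw [key, lagrangianOneForm_apply] at h1
    exact h1
  · intro h w
    have h1 := h (w : E × E).1
    erw [key, lagrangianOneForm_apply]
    exact h1

end Mechanics

/-! ### The action of `ℝ⁺` as a flow in logarithmic time. -/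

section PosReal

lemma posExp_zero : posExp 0 = 1 := Subtype.ext Real.exp_zero

lemma posExp_add (s t : ℝ) : posExp (s + t) = posExp s * posExp t := Subtype.ext (Real.exp_add s t)

lemma posExp_neg (t : ℝ) : posExp (-t) = (posExp t)⁻¹ := Subtype.ext (Real.exp_neg t)

lemma posExp_log (g : PosReal) : posExp (Real.log g) = g := Subtype.ext (Real.exp_log g.2)

lemma posExp_rpow (t r : ℝ) : ((posExp t : PosReal) : ℝ) ^ r = Real.exp (t * r) :=
  (Real.exp_mul t r).symm

end PosReal

section Action

variable {E : Type*} [NormedAddCommGroup E] [NormedSpace ℝ E]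
  {Q : Type*} [TopologicalSpace Q] [ChartedSpace E Q]

namespace ScalingAction

variable (Ψ : ScalingAction E Q)

/-- The action as a flow. -/
def flow (τ : ℝ) (q : Q) : Q := Ψ.act (posExp τ) q

lemma flow_zero (q : Q) : Ψ.flow 0 q = q := by
  rw [flow, posExp_zero, Ψ.one_act]

lemma contMDiff_flow :
    ContMDiff (𝓘(ℝ, ℝ).prod 𝓘(ℝ, E)) 𝓘(ℝ, E) ∞ (fun p : ℝ × Q => Ψ.flow p.1 p.2) :=
  Ψ.smooth

lemma inv_act_act (g : PosReal) (q : Q) : Ψ.act g⁻¹ (Ψ.act g q) = q := by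
  rw [← Ψ.mul_act, inv_mul_cancel, Ψ.one_act]

/-- The derivative of `Ψ_g`. -/
def tact (g : PosReal) (q : Q) : E →L[ℝ] E := tderiv 𝓘(ℝ, E) 𝓘(ℝ, E) (Ψ.act g) q

lemma tact_one (q : Q) : Ψ.tact 1 q = ContinuousLinearMap.id ℝ E := by
  have : Ψ.act 1 = fun q => q := funext Ψ.one_act
  rw [tact, this, tderiv_id]

lemma contMDiff_act (g : PosReal) : ContMDiff 𝓘(ℝ, E) 𝓘(ℝ, E) ∞ (Ψ.act g) := by
  have := Ψ.contMDiff_flow.comp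
    ((contMDiff_const (c := Real.log g)).prodMk (contMDiff_id (I := 𝓘(ℝ, E)) (M := Q)))
  simpa only [Function.comp_def, flow, posExp_log, id_eq] using this

lemma mdifferentiableAt_act (g : PosReal) (q : Q) :
    MDifferentiableAt 𝓘(ℝ, E) 𝓘(ℝ, E) (Ψ.act g) q :=
  (Ψ.contMDiff_act g).mdifferentiable (by simp) q

lemma tact_mul (g h : PosReal) (q : Q) :
    Ψ.tact (g * h) q = (Ψ.tact g (Ψ.act h q)).comp (Ψ.tact h q) := by
  have : Ψ.act (g * h) = fun q => Ψ.act g (Ψ.act h q) := funext (Ψ.mul_act g h)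
  rw [tact, this]
  exact tderiv_comp q (Ψ.mdifferentiableAt_act g _) (Ψ.mdifferentiableAt_act h q)

lemma tact_inv_comp (g : PosReal) (q : Q) :
    (Ψ.tact g⁻¹ (Ψ.act g q)).comp (Ψ.tact g q) = ContinuousLinearMap.id ℝ E := by
  rw [← tact_mul, inv_mul_cancel, tact_one]

lemma tact_comp_inv (g : PosReal) (q : Q) :
    (Ψ.tact g q).comp (Ψ.tact g⁻¹ (Ψ.act g q)) = ContinuousLinearMap.id ℝ E := by
  have := Ψ.tact_mul g g⁻¹ (Ψ.act g q)
  rwa [mul_inv_cancel, tact_one, Ψ.inv_act_act, eq_comm] at this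

/-- The generator of the action for `ξ = 1`, with values in the model space. -/
def vel (q : Q) : E := flowGenerator 𝓘(ℝ, E) Ψ.flow q

lemma generator_eq (ξ : ℝ) (q : Q) : (Ψ.generator ξ q : E) = ξ • Ψ.vel q := by
  have h1 := tderiv_comp (I := 𝓘(ℝ, ℝ)) (I' := 𝓘(ℝ, ℝ)) (I'' := 𝓘(ℝ, E))
    (g := fun τ => Ψ.flow τ q) (f := fun τ => τ * ξ) 0
    ((contMDiff_flow_left Ψ.contMDiff_flow q).mdifferentiable (by simp) _)
    (mdifferentiableAt_iff_differentiableAt.2 (by fun_prop))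
  have h2 : HasFDerivAt (fun τ : ℝ => τ * ξ) (ξ • ContinuousLinearMap.id ℝ ℝ) 0 := by
    simpa using (hasFDerivAt_id (𝕜 := ℝ) (0 : ℝ)).mul_const ξ
  rw [tderiv_eq_fderiv, h2.fderiv, zero_mul] at h1
  refine (congrArg (fun L => L 1) h1).trans ?_
  simp [vel, flowGenerator]

variable [IsManifold 𝓘(ℝ, E) ∞ Q]

lemma contMDiffAt_vel (q₀ : Q) : ContMDiffAt 𝓘(ℝ, E) 𝓘(ℝ, E) ∞
    (fun q => tderiv 𝓘(ℝ, E) 𝓘(ℝ, E) (extChartAt 𝓘(ℝ, E) q₀) q (Ψ.vel q)) q₀ :=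
  contMDiffAt_tderiv_extChartAt_flowGenerator Ψ.contMDiff_flow Ψ.flow_zero q₀

/-- The function `⟨p_q, 1_Q(q)⟩` on `T*Q`. -/
def momentumFunction (β : CotangentBundle E Q) : ℝ := momentum β (Ψ.vel β.1)

lemma contMDiff_momentumFunction :
    ContMDiff (cotangentModel E) 𝓘(ℝ, ℝ) ∞ Ψ.momentumFunction := by
  intro z
  have h1 := (contMDiffAt_extChartAt_cotangent_snd z).clm_apply
    ((Ψ.contMDiffAt_vel z.1).comp z (contMDiff_cotangent_proj z))
  refine h1.congr_of_eventuallyEq ?_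
  filter_upwards [eventually_mem_chart_cotangent z] with β hβ
  exact momentum_apply_eq_chart hβ _

lemma augmentedPotential_eq (m : Metric E Q) (U : Q → ℝ) (ξ : ℝ) (q : Q) :
    augmentedPotential m U Ψ ξ q =
      U q - 1 / 2 * metricAt m q (ξ • Ψ.vel q) (ξ • Ψ.vel q) := by
  rw [← generator_eq]
  rfl

lemma contMDiff_augmentedPotential (m : Metric E Q) {U : Q → ℝ}
    (hU : ContMDiff 𝓘(ℝ, E) 𝓘(ℝ, ℝ) ∞ U) (ξ : ℝ) :
    ContMDiff 𝓘(ℝ, E) 𝓘(ℝ, ℝ) ∞ (augmentedPotential m U Ψ ξ) := by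
  intro q₀
  have hv := (contMDiffAt_const (I := 𝓘(ℝ, E)) (I' := 𝓘(ℝ, ℝ)) (c := ξ)).smul (Ψ.contMDiffAt_vel q₀)
  have h1 := (hU q₀).sub ((contMDiffAt_const (I := 𝓘(ℝ, E)) (I' := 𝓘(ℝ, ℝ)) (c := (1 / 2 : ℝ))).mul
    (((contMDiffAt_metricInChart m q₀).clm_apply hv).clm_apply hv))
  refine h1.congr_of_eventuallyEq ?_
  filter_upwards [chart_source_mem_nhds E q₀] with q hq
  rw [augmentedPotential_eq, metricAt_eq_chart m hq, map_smul]
  rfl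

end ScalingAction

end Action

/-! ### The scaled cotangent lift: group law, smoothness, effect on the canonical forms. -/

section CotangentLift

variable {E : Type*} [NormedAddCommGroup E] [NormedSpace ℝ E]
  {Q : Type*} [TopologicalSpace Q] [ChartedSpace E Q]

lemma cotangent_ext {α β : CotangentBundle E Q} (h₁ : α.1 = β.1) (h₂ : momentum α = momentum β) :
    α = β := by
  rcases α with ⟨q, p⟩
  rcases β with ⟨q', p'⟩
  change q = q' at h₁
  subst h₁
  change p = p' at h₂
  rw [h₂]

namespace ScalingAction

variable (Ψ : ScalingAction E Q) (c : ℝ)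

lemma cotangentLift_fst (g : PosReal) (β : CotangentBundle E Q) :
    (Ψ.cotangentLift c g β).1 = Ψ.act g β.1 := rfl

lemma momentum_cotangentLift (g : PosReal) (β : CotangentBundle E Q) :
    momentum (Ψ.cotangentLift c g β) =
      (g : ℝ) ^ c • (momentum β).comp (Ψ.tact g⁻¹ (Ψ.act g β.1)) := rfl

lemma cotangentLift_one (β : CotangentBundle E Q) : Ψ.cotangentLift c 1 β = β := by
  refine cotangent_ext (Ψ.one_act _) ?_
  rw [momentum_cotangentLift, inv_one, Ψ.tact_one]
  change (1 : ℝ) ^ c • _ = _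
  rw [Real.one_rpow, one_smul, ContinuousLinearMap.comp_id]

lemma cotangentLift_mul (g h : PosReal) (β : CotangentBundle E Q) :
    Ψ.cotangentLift c (g * h) β = Ψ.cotangentLift c g (Ψ.cotangentLift c h β) := by
  refine cotangent_ext (Ψ.mul_act g h _) ?_
  rw [momentum_cotangentLift, momentum_cotangentLift, momentum_cotangentLift, cotangentLift_fst,
    mul_inv_rev, Ψ.tact_mul, Ψ.mul_act, Ψ.inv_act_act]
  change ((g : ℝ) * h) ^ c • _ = _
  rw [Real.mul_rpow g.2.le h.2.le, ContinuousLinearMap.smul_comp, smul_smul,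
    ContinuousLinearMap.comp_assoc]

/-- If some point of an orbit is fixed, moving it back by `g⁻¹` does not change it, so the orbit is
a single point. -/
lemma eq_of_cotangentLift_fixed {g : PosReal} {z : CotangentBundle E Q}
    (h : ∀ h, Ψ.cotangentLift c h (Ψ.cotangentLift c g z) = Ψ.cotangentLift c g z) :
    Ψ.cotangentLift c g z = z := by
  rw [← h g⁻¹, ← cotangentLift_mul, inv_mul_cancel, cotangentLift_one]

/-- The scaled cotangent lift as a flow. -/
def liftFlow (τ : ℝ) (β : CotangentBundle E Q) : CotangentBundle E Q :=
  Ψ.cotangentLift c (posExp τ) β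

lemma liftFlow_zero (β : CotangentBundle E Q) : Ψ.liftFlow c 0 β = β := by
  rw [liftFlow, posExp_zero, cotangentLift_one]

lemma liftFlow_add (s t : ℝ) (β : CotangentBundle E Q) :
    Ψ.liftFlow c (s + t) β = Ψ.liftFlow c s (Ψ.liftFlow c t β) := by
  rw [liftFlow, posExp_add, cotangentLift_mul]
  rfl

variable [IsManifold 𝓘(ℝ, E) ∞ Q]

/-- Joint smoothness in time and base point of the coordinate expression of `TΨ_{g⁻¹}`, with the
chart at `Ψ_g(q₀)` for the initial `g` on the source side and the chart at `q₀` on the target side.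
It is the fibre part of the lift. -/
lemma contMDiffAt_tact_inv (s₀ : ℝ) (q₀ : Q) :
    ContMDiffAt (𝓘(ℝ, ℝ).prod 𝓘(ℝ, E)) 𝓘(ℝ, E →L[ℝ] E) ∞ (fun x : ℝ × Q =>
      (tderiv 𝓘(ℝ, E) 𝓘(ℝ, E) (extChartAt 𝓘(ℝ, E) q₀) x.2).comp
        ((Ψ.tact (posExp x.1)⁻¹ (Ψ.act (posExp x.1) x.2)).comp
          (fromChart (Ψ.act (posExp s₀) q₀) (Ψ.act (posExp x.1) x.2)))) (s₀, q₀) := by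
  have hf : ContMDiffAt ((𝓘(ℝ, ℝ).prod 𝓘(ℝ, E)).prod 𝓘(ℝ, E)) 𝓘(ℝ, E) ∞
      (Function.uncurry (fun (x : ℝ × Q) (q : Q) => Ψ.act (posExp x.1)⁻¹ q))
      ((s₀, q₀), Ψ.act (posExp s₀) q₀) := by
    simp_rw [← posExp_neg]
    have h1 : ContMDiff ((𝓘(ℝ, ℝ).prod 𝓘(ℝ, E)).prod 𝓘(ℝ, E)) (𝓘(ℝ, ℝ).prod 𝓘(ℝ, E)) ∞
        (fun x : (ℝ × Q) × Q => (-x.1.1, x.2)) :=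
      ((contDiff_neg.contMDiff.comp contMDiff_fst).comp contMDiff_fst).prodMk contMDiff_snd
    exact Ψ.contMDiff_flow.comp h1 _
  have h := ContMDiffAt.mfderiv (m := ∞) (n := ∞) (J := 𝓘(ℝ, ℝ).prod 𝓘(ℝ, E)) (x₀ := (s₀, q₀))
    (fun (x : ℝ × Q) (q : Q) => Ψ.act (posExp x.1)⁻¹ q) (fun x => Ψ.act (posExp x.1) x.2) hf
    (Ψ.contMDiff_flow _) (by simp)
  refine h.congr_of_eventuallyEq ?_
  have hc1 : ∀ᶠ x : ℝ × Q in 𝓝 (s₀, q₀), x.2 ∈ (chartAt E q₀).source :=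
    continuousAt_snd.preimage_mem_nhds (chart_source_mem_nhds E q₀)
  filter_upwards [hc1] with x hx
  simp only [inTangentCoordinates, ContinuousLinearMap.inCoordinates, Ψ.inv_act_act]
  -- The base point `Ψ_{g⁻¹}(Ψ_g(x.2))` equals `x.2` only propositionally; generalising it to a
  -- variable `q` lets the equation be substituted.
  have key : ∀ q, q = x.2 → tderiv 𝓘(ℝ, E) 𝓘(ℝ, E) (extChartAt 𝓘(ℝ, E) q₀) x.2 =
      ((trivializationAt E (TangentSpace 𝓘(ℝ, E)) q₀).continuousLinearMapAt ℝ q : E →L[ℝ] E) := by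
    rintro _ rfl
    exact (TangentBundle.continuousLinearMapAt_trivializationAt hx).symm
  exact congrArg (fun L : E →L[ℝ] E => L.comp _) (key _ (Ψ.inv_act_act _ _))

lemma contMDiff_liftFlow :
    ContMDiff (𝓘(ℝ, ℝ).prod (cotangentModel E)) (cotangentModel E) ∞
      (fun p : ℝ × CotangentBundle E Q => Ψ.liftFlow c p.1 p.2) := by
  rintro ⟨s₀, β₀⟩
  rw [contMDiffAt_totalSpace]
  have hb : ContMDiff (𝓘(ℝ, ℝ).prod (cotangentModel E)) (𝓘(ℝ, ℝ).prod 𝓘(ℝ, E)) ∞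
      (fun p : ℝ × CotangentBundle E Q => (p.1, p.2.1)) :=
    contMDiff_fst.prodMk (contMDiff_cotangent_proj.comp contMDiff_snd)
  refine ⟨Ψ.contMDiff_flow.comp hb _, ?_⟩
  have h1 := ContMDiffAt.comp (s₀, β₀) (Ψ.contMDiffAt_tact_inv s₀ β₀.1) (hb _)
  have h2 : ContMDiffAt (𝓘(ℝ, ℝ).prod (cotangentModel E)) 𝓘(ℝ, E →L[ℝ] ℝ) ∞
      (fun p : ℝ × CotangentBundle E Q => (extChartAt (cotangentModel E) β₀ p.2).2) (s₀, β₀) :=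
    ContMDiffAt.comp (I' := cotangentModel E) (f := Prod.snd) (s₀, β₀)
      (contMDiffAt_extChartAt_cotangent_snd β₀) contMDiffAt_snd
  have h3 : ContMDiffAt (𝓘(ℝ, ℝ).prod (cotangentModel E)) 𝓘(ℝ, ℝ) ∞
      (fun p : ℝ × CotangentBundle E Q => Real.exp (p.1 * c)) (s₀, β₀) := by
    have : ContDiff ℝ ∞ (fun s : ℝ => Real.exp (s * c)) := by fun_prop
    exact this.contMDiff.contMDiffAt.comp (s₀, β₀) contMDiffAt_fst
  refine (h3.smul (h2.clm_comp h1)).congr_of_eventuallyEq ?_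
  have hc1 : ∀ᶠ x : ℝ × CotangentBundle E Q in 𝓝 (s₀, β₀), x.2.1 ∈ (chartAt E β₀.1).source :=
    (continuous_snd.tendsto (s₀, β₀)).eventually (eventually_mem_chart_cotangent β₀)
  filter_upwards [hc1] with x hx
  refine ContinuousLinearMap.ext fun v => ?_
  have h4 := extChartAt_cotangent_snd_apply (Ψ.liftFlow c s₀ β₀) (Ψ.liftFlow c x.1 x.2) v
  rw [extChartAt_totalSpace_snd] at h4
  refine h4.trans ?_
  change ((posExp x.1 : PosReal) : ℝ) ^ c • momentum x.2 _ = Real.exp (x.1 * c) • _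
  rw [posExp_rpow]
  congr 1
  exact momentum_apply_eq_chart hx _

lemma contMDiff_cotangentLift (g : PosReal) :
    ContMDiff (cotangentModel E) (cotangentModel E) ∞ (Ψ.cotangentLift c g) := by
  have := (Ψ.contMDiff_liftFlow c).comp ((contMDiff_const (c := Real.log g)).prodMk
    (contMDiff_id (I := cotangentModel E) (M := CotangentBundle E Q)))
  simpa only [Function.comp_def, liftFlow, posExp_log, id_eq] using this

/-- The derivative of the scaled cotangent lift. -/
def tlift (g : PosReal) (β : CotangentBundle E Q) : E × (E →L[ℝ] ℝ) →L[ℝ] E × (E →L[ℝ] ℝ) :=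
  tderiv (cotangentModel E) (cotangentModel E) (Ψ.cotangentLift c g) β

lemma mdifferentiableAt_cotangentLift (g : PosReal) (β : CotangentBundle E Q) :
    MDifferentiableAt (cotangentModel E) (cotangentModel E) (Ψ.cotangentLift c g) β :=
  (Ψ.contMDiff_cotangentLift c g).mdifferentiable (by simp) β

lemma tlift_fst (g : PosReal) (β : CotangentBundle E Q) (w : E × (E →L[ℝ] ℝ)) :
    (Ψ.tlift c g β w).1 = Ψ.tact g β.1 w.1 := by
  have h1 := tderiv_comp (I := cotangentModel E) (I' := cotangentModel E) (I'' := 𝓘(ℝ, E))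
    (g := fun α : CotangentBundle E Q => α.1) (f := Ψ.cotangentLift c g) β
    (hasMFDerivAt_totalSpace_proj _).mdifferentiableAt (Ψ.mdifferentiableAt_cotangentLift c g β)
  have h2 := tderiv_comp (I := cotangentModel E) (I' := 𝓘(ℝ, E)) (I'' := 𝓘(ℝ, E))
    (g := Ψ.act g) (f := fun α : CotangentBundle E Q => α.1) β
    (Ψ.mdifferentiableAt_act g _) (hasMFDerivAt_totalSpace_proj _).mdifferentiableAt
  have h3 (α : CotangentBundle E Q) : tderiv (cotangentModel E) 𝓘(ℝ, E)
      (fun α : CotangentBundle E Q => α.1) α = ContinuousLinearMap.fst ℝ _ _ :=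
    mfderiv_totalSpace_proj _
  rw [h3] at h1 h2
  exact congrArg (fun L => L w) (h1.symm.trans h2)

/-- The lift covers `Ψ_g`, so `TΨ_{g⁻¹}` in the covector cancels `TΨ_g` on the vector and only the
factor `g^c` remains. -/
lemma canonicalOneForm_tlift (g : PosReal) (β : CotangentBundle E Q) (w : E × (E →L[ℝ] ℝ)) :
    canonicalOneForm (Ψ.cotangentLift c g β) (Ψ.tlift c g β w) =
      (g : ℝ) ^ c * canonicalOneForm β w := by
  rw [canonicalOneForm_apply, canonicalOneForm_apply, tlift_fst]
  change (g : ℝ) ^ c * momentum β (Ψ.tact g⁻¹ (Ψ.act g β.1) (Ψ.tact g β.1 w.1)) = _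
  congr 2
  exact congrArg (fun L => L w.1) (Ψ.tact_inv_comp g β.1)

lemma modelTwoForm_tlift (g : PosReal) (β : CotangentBundle E Q) (v w : E × (E →L[ℝ] ℝ)) :
    modelTwoForm E (Ψ.tlift c g β v) (Ψ.tlift c g β w) = (g : ℝ) ^ c * modelTwoForm E v w :=
  modelTwoForm_tderiv_self_map (Ψ.contMDiff_cotangentLift c g) (Ψ.canonicalOneForm_tlift c g) β v w

/-- Allows test vectors at `Φ_g(β)` to be taken as images of vectors at `β`. -/
lemma tlift_surjective (g : PosReal) (β : CotangentBundle E Q) :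
    Function.Surjective (Ψ.tlift c g β) := by
  have h0 : (fun β => Ψ.cotangentLift c g (Ψ.cotangentLift c g⁻¹ β)) = fun β => β := by
    funext β
    rw [← cotangentLift_mul, mul_inv_cancel, cotangentLift_one]
  have h1 := tderiv_comp (I := cotangentModel E) (I' := cotangentModel E) (I'' := cotangentModel E)
    (g := Ψ.cotangentLift c g) (f := Ψ.cotangentLift c g⁻¹) (Ψ.cotangentLift c g β)
    (Ψ.mdifferentiableAt_cotangentLift c g _) (Ψ.mdifferentiableAt_cotangentLift c g⁻¹ _)
  rw [h0, tderiv_id, ← cotangentLift_mul, inv_mul_cancel, cotangentLift_one] at h1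
  exact fun w => ⟨_, (congrArg (fun L => L w) h1).symm⟩

end ScalingAction

end CotangentLift

/-! ### The momentum equation `i_Z ω = dJ - c θ`. -/

section FlowTwoForm

variable {W : Type*} [NormedAddCommGroup W] [NormedSpace ℝ W]

/-- If a local flow `f s` multiplies the one-form `A` by `e^{cs}` along the orbit of `u₀`, then its
generator `Z` satisfies `i_Z (-dA) = d(A(Z)) - c A` at `u₀`. -/
lemma twoFormOf_flow (A : W →L[ℝ] W →L[ℝ] ℝ) {f : ℝ × W → W} {u₀ : W}
    (hf : ContDiffAt ℝ ∞ f (0, u₀)) (h0 : ∀ᶠ u in 𝓝 u₀, f (0, u) = u) {c : ℝ}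
    (h : ∀ᶠ s in 𝓝 (0 : ℝ), ∀ w, A (f (s, u₀)) (fderiv ℝ f (s, u₀) (0, w)) =
      Real.exp (s * c) * A u₀ w) (w : W) :
    twoFormOf A (fderiv ℝ f (0, u₀) (1, 0)) w =
      fderiv ℝ (fun u => A u (fderiv ℝ f (0, u) (1, 0))) u₀ w - c * A u₀ w := by
  have hd : HasFDerivAt f (fderiv ℝ f (0, u₀)) (0, u₀) :=
    (hf.differentiableAt (by simp)).hasFDerivAt
  have hdd : HasFDerivAt (fderiv ℝ f) (fderiv ℝ (fderiv ℝ f) (0, u₀)) (0, u₀) :=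
    ((hf.fderiv_right (m := ∞) (by simp)).differentiableAt (by simp)).hasFDerivAt
  have hl : HasFDerivAt (fun s : ℝ => (s, u₀)) (ContinuousLinearMap.inl ℝ ℝ W) 0 :=
    hasFDerivAt_prodMk_left 0 _
  have hr : HasFDerivAt (fun u : W => ((0 : ℝ), u)) (ContinuousLinearMap.inr ℝ ℝ W) u₀ :=
    hasFDerivAt_prodMk_right 0 _
  have hf0 : f (0, u₀) = u₀ := h0.self_of_nhds
  have hid : fderiv ℝ f (0, u₀) (0, w) = w := by
    have h1 : HasFDerivAt (fun u => f (0, u)) _ u₀ := hd.comp u₀ hr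
    have h2 := h1.unique ((hasFDerivAt_id (𝕜 := ℝ) u₀).congr_of_eventuallyEq h0)
    exact congrArg (fun L => L w) h2
  -- Cartan's formula by hand: the time derivative at `0` expresses that the Lie derivative of `A`
  -- along the generator is `c A`.
  have hs : HasFDerivAt (fun s : ℝ => A (f (s, u₀)) (fderiv ℝ f (s, u₀) (0, w))) _ 0 :=
    (A.hasFDerivAt.comp (0 : ℝ) (hd.comp (0 : ℝ) hl)).clm_apply
      ((hdd.comp (0 : ℝ) hl).clm_apply (hasFDerivAt_const ((0 : ℝ), w) 0))
  have he : HasDerivAt (fun s : ℝ => Real.exp (s * c) * A u₀ w) (c * A u₀ w) 0 := by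
    have h1 := (((hasDerivAt_id (0 : ℝ)).mul_const c).exp).mul_const (A u₀ w)
    simpa using h1
  have h1 := hs.unique (he.hasFDerivAt.congr_of_eventuallyEq (h.mono fun s hs => hs w))
  have h1' := congrArg (fun L => L (1 : ℝ)) h1
  have hJ : HasFDerivAt (fun u => A u (fderiv ℝ f (0, u) (1, 0))) _ u₀ :=
    (A.hasFDerivAt (x := u₀)).clm_apply
      ((hdd.comp u₀ hr).clm_apply (hasFDerivAt_const ((1 : ℝ), (0 : W)) u₀))
  -- The mixed derivative of `f` occurs both in the time derivative and in the differential of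
  -- `A(Z)`, and cancels by symmetry.
  have hsym : fderiv ℝ (fderiv ℝ f) (0, u₀) (1, 0) (0, w) =
      fderiv ℝ (fderiv ℝ f) (0, u₀) (0, w) (1, 0) :=
    (hf.of_le (n := ∞) (m := 2) (by norm_cast)).isSymmSndFDerivAt (by simp) _ _
  rw [hJ.fderiv, twoFormOf_apply]
  simp [hf0, hid, hsym] at h1' ⊢
  linarith

end FlowTwoForm

section MinimumPoints

variable {F H M : Type*} [NormedAddCommGroup F] [NormedSpace ℝ F] [TopologicalSpace H]
  {I : ModelWithCorners ℝ F H} [I.Boundaryless] [TopologicalSpace M] [ChartedSpace H M]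
  [IsManifold I 1 M]

/-- Moves derivatives of functions to a vector space, where the criterion for local minima and
derivatives along lines are available. -/
lemma tderiv_eq_fderiv_chart {f : M → ℝ} {x : M} (hf : MDifferentiableAt I 𝓘(ℝ, ℝ) f x) :
    HasFDerivAt (fun u => f ((extChartAt I x).symm u)) (tderiv I 𝓘(ℝ, ℝ) f x)
      (extChartAt I x x) := by
  have hx : (extChartAt I x).symm (extChartAt I x x) = x := extChartAt_to_inv x
  have hs := mdifferentiableAt_extChartAt_symm' (mem_extChartAt_target (I := I) x)
  have hf' : MDifferentiableAt I 𝓘(ℝ, ℝ) f ((extChartAt I x).symm (extChartAt I x x)) := by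
    rwa [hx]
  have h1 := tderiv_comp (I'' := 𝓘(ℝ, ℝ)) (extChartAt I x x) hf' hs
  rw [tderiv_extChartAt_symm_self, hx, ContinuousLinearMap.comp_id, tderiv_eq_fderiv] at h1
  rw [← h1]
  exact (mdifferentiableAt_iff_differentiableAt.1 (hf'.comp _ hs)).hasFDerivAt

end MinimumPoints

section HamiltonianSymmetry

variable {E : Type*} [NormedAddCommGroup E] [NormedSpace ℝ E]
  {Q : Type*} [TopologicalSpace Q] [ChartedSpace E Q] [IsManifold 𝓘(ℝ, E) ∞ Q]

namespace ScalingAction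

variable (Ψ : ScalingAction E Q) (c : ℝ)

/-- The generator of the scaled cotangent lift. -/
def liftVel (β : CotangentBundle E Q) : E × (E →L[ℝ] ℝ) :=
  flowGenerator (cotangentModel E) (Ψ.liftFlow c) β

lemma liftVel_fst (β : CotangentBundle E Q) : (Ψ.liftVel c β).1 = Ψ.vel β.1 := by
  have h1 := tderiv_comp (I := 𝓘(ℝ, ℝ)) (I' := cotangentModel E) (I'' := 𝓘(ℝ, E))
    (g := fun α : CotangentBundle E Q => α.1) (f := fun τ => Ψ.liftFlow c τ β) 0
    (hasMFDerivAt_totalSpace_proj _).mdifferentiableAt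
    ((contMDiff_flow_left (Ψ.contMDiff_liftFlow c) β).mdifferentiable (by simp) 0)
  have h3 (α : CotangentBundle E Q) : tderiv (cotangentModel E) 𝓘(ℝ, E)
      (fun α : CotangentBundle E Q => α.1) α = ContinuousLinearMap.fst ℝ _ _ :=
    mfderiv_totalSpace_proj _
  rw [h3] at h1
  exact (congrArg (fun L => L 1) h1).symm

/-- This is `twoFormOf_flow` for the lifted flow in a bundle chart. Since `Z` covers the generator
on `Q`, the function `θ(Z)` is `J`. -/
lemma modelTwoForm_liftVel (z : CotangentBundle E Q) (w : E × (E →L[ℝ] ℝ)) :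
    modelTwoForm E (Ψ.liftVel c z) w =
      tderiv (cotangentModel E) 𝓘(ℝ, ℝ) Ψ.momentumFunction z w - c * momentum z w.1 := by
  set φ := extChartAt (cotangentModel E) z with hφ
  set f := flowInChart (cotangentModel E) (Ψ.liftFlow c) z with hf
  have hzt : φ z ∈ φ.target := mem_extChartAt_target (I := cotangentModel E) z
  have hsm := Ψ.contMDiff_liftFlow c
  have hfd := contDiffAt_flowInChart hsm (Ψ.liftFlow_zero c) z hzt
  have hgen (β : CotangentBundle E Q) (hβ : β ∈ (chartAt (ModelProd E (E →L[ℝ] ℝ)) z).source) :=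
    tderiv_extChartAt_flowGenerator hsm (Ψ.liftFlow_zero c) hβ
  have hζ : Ψ.liftVel c z = fderiv ℝ f (0, φ z) (1, 0) := by
    have := hgen z (mem_chart_source _ z)
    rwa [tderiv_extChartAt_self] at this
  have hA (w : E × (E →L[ℝ] ℝ)) : modelOneForm E (φ z) w = momentum z w.1 := by
    have := modelOneForm_extChartAt (mem_chart_source E z.1) w
    rwa [tderiv_extChartAt_self, canonicalOneForm_apply] at this
  have hJ : (fun u => Ψ.momentumFunction (φ.symm u)) =ᶠ[𝓝 (φ z)]
      fun u => modelOneForm E u (fderiv ℝ f (0, u) (1, 0)) := by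
    filter_upwards [extChartAt_target_mem_nhds (I := cotangentModel E) z] with u hu
    have hm : φ.symm u ∈ (chartAt (ModelProd E (E →L[ℝ] ℝ)) z).source := by
      rw [← extChartAt_source (cotangentModel E)]
      exact φ.map_target hu
    have h1 := modelOneForm_extChartAt (mem_chart_cotangent_source.1 hm) (Ψ.liftVel c (φ.symm u))
    have h2 := hgen _ hm
    rw [φ.right_inv hu] at h2 h1
    rw [canonicalOneForm_apply, liftVel_fst] at h1
    rw [← h2]
    exact h1.symm
  have hJd := (tderiv_eq_fderiv_chart
    (Ψ.contMDiff_momentumFunction.mdifferentiable (by simp) z)).congr_of_eventuallyEq hJ.symm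
  rw [hζ, ← hA, ← hJd.fderiv]
  refine twoFormOf_flow (modelOneForm E) hfd ?_ ?_ w
  · filter_upwards [extChartAt_target_mem_nhds (I := cotangentModel E) z] with u hu
    exact flowInChart_zero (Ψ.liftFlow_zero c) z hu
  · have hcont : Continuous (fun s : ℝ => Ψ.liftFlow c s z) :=
      (contMDiff_flow_left hsm z).continuous
    have hm : ∀ᶠ s in 𝓝 (0 : ℝ),
        Ψ.liftFlow c s z ∈ (chartAt (ModelProd E (E →L[ℝ] ℝ)) z).source := by
      refine hcont.continuousAt.preimage_mem_nhds ?_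
      rw [Ψ.liftFlow_zero]
      exact chart_source_mem_nhds _ z
    have hfs : ∀ᶠ s in 𝓝 (0 : ℝ), DifferentiableAt ℝ f (s, φ z) := by
      have h1 := (hfd.of_le (m := 1) (by simp)).eventually (by simp)
      have h2 : Tendsto (fun s : ℝ => (s, φ z)) (𝓝 0) (𝓝 (0, φ z)) :=
        (continuous_id.prodMk continuous_const).tendsto 0
      exact (h2.eventually h1).mono fun s hs => hs.differentiableAt (by simp)
    filter_upwards [hm, hfs] with s hs hds w
    have hsymm : φ.symm (φ z) = z := extChartAt_to_inv z
    have h1 : f (s, φ z) = φ (Ψ.liftFlow c s z) :=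
      flowInChart_apply (Ψ.liftFlow c) (mem_chart_source _ z) s
    -- The space derivative at time `s` is the derivative of the lift by `e^s`, read in the chart;
    -- this brings in the factor `e^{sc}`.
    have h2 : fderiv ℝ f (s, φ z) (0, w) =
        tderiv (cotangentModel E) 𝓘(ℝ, E × (E →L[ℝ] ℝ)) φ (Ψ.liftFlow c s z)
          (Ψ.tlift c (posExp s) z w) := by
      have h3 : HasFDerivAt (fun u => f (s, u)) ((fderiv ℝ f (s, φ z)).comp
          (ContinuousLinearMap.inr ℝ ℝ _)) (φ z) :=
        hds.hasFDerivAt.comp (φ z) (hasFDerivAt_prodMk_right s _)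
      have hmd := Ψ.mdifferentiableAt_cotangentLift c (posExp s) (φ.symm (φ z))
      have hmφ := mdifferentiableAt_extChartAt_symm' hzt
      have h4 := tderiv_comp (I'' := cotangentModel E) (φ z) hmd hmφ
      have h5 := tderiv_comp (I := 𝓘(ℝ, E × (E →L[ℝ] ℝ))) (I' := cotangentModel E)
        (I'' := 𝓘(ℝ, E × (E →L[ℝ] ℝ))) (g := φ)
        (f := fun u => Ψ.liftFlow c s (φ.symm u)) (φ z)
        (by rw [hsymm]; exact mdifferentiableAt_extChartAt hs) (hmd.comp _ hmφ)
      rw [tderiv_eq_fderiv] at h5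
      have h6 := h3.fderiv.symm.trans h5
      have h7 := congrArg (fun L => L w) h6
      refine h7.trans ?_
      change tderiv (cotangentModel E) 𝓘(ℝ, E × (E →L[ℝ] ℝ)) φ (Ψ.liftFlow c s (φ.symm (φ z)))
        (tderiv 𝓘(ℝ, E × (E →L[ℝ] ℝ)) (cotangentModel E)
          (fun u => Ψ.cotangentLift c (posExp s) (φ.symm u)) (φ z) w) = _
      rw [h4, tderiv_extChartAt_symm_self, ContinuousLinearMap.comp_id, hsymm]
      rfl
    rw [← hf, h1, h2]
    refine (modelOneForm_extChartAt (mem_chart_cotangent_source.1 hs) _).trans ?_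
    refine (Ψ.canonicalOneForm_tlift c (posExp s) z w).trans ?_
    rw [posExp_rpow, canonicalOneForm_apply, hA]
    rfl

end ScalingAction

end HamiltonianSymmetry

/-! ### Condition (C) as tangency of `X_H` to the orbit. -/

section RelativeEquilibria

variable {E : Type*} [NormedAddCommGroup E] [NormedSpace ℝ E]
  {Q : Type*} [TopologicalSpace Q] [ChartedSpace E Q] [IsManifold 𝓘(ℝ, E) ∞ Q]

lemma fromChart_self (q : Q) : fromChart q q = ContinuousLinearMap.id ℝ E := by
  refine ContinuousLinearMap.ext fun v => ?_
  have := fromChart_tderiv (mem_chart_source E q) v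
  rwa [tderiv_extChartAt_self] at this

lemma modelTwoForm_smul (r : ℝ) (v w : E × (E →L[ℝ] ℝ)) :
    modelTwoForm E (r • v) w = r * modelTwoForm E v w := by
  rw [modelTwoForm_apply, modelTwoForm_apply]
  change w.2 (r • v.1) - r • v.2 w.1 = _
  rw [map_smul, smul_eq_mul, smul_eq_mul]
  ring

variable [FiniteDimensional ℝ E] (m : Metric E Q) {U : Q → ℝ}

lemma sharp_symm (q : Q) (p p' : E →L[ℝ] ℝ) : p (sharp m q p') = p' (sharp m q p) := by
  conv_lhs => rw [← metricAt_sharp m q p]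
  conv_rhs => rw [← metricAt_sharp m q p']
  exact metricAt_symm m q _ _

/-- The vertical derivative of the Hamiltonian. -/
lemma tderiv_hamiltonian_vertical (hU : ContMDiff 𝓘(ℝ, E) 𝓘(ℝ, ℝ) ∞ U) (z : CotangentBundle E Q)
    (η : E →L[ℝ] ℝ) :
    tderiv (cotangentModel E) 𝓘(ℝ, ℝ) (hamiltonian m U) z (0, η) =
      η (sharp m z.1 (momentum z)) := by
  set φ := extChartAt (cotangentModel E) z with hφ
  have h1 := tderiv_eq_fderiv_chart
    ((contMDiff_hamiltonian m hU).mdifferentiable (by simp) z)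
  have hcurve : HasDerivAt (fun t : ℝ => φ z + t • ((0 : E), η)) (0, η) 0 := by
    simpa using ((hasDerivAt_id (0 : ℝ)).smul_const ((0 : E), η)).const_add (φ z)
  have h0 : φ z + (0 : ℝ) • ((0 : E), η) = φ z := by simp
  have h2 := HasFDerivAt.comp_hasDerivAt (0 : ℝ) (by rw [h0]; exact h1) hcurve
  -- A vertical line in the chart at `z` through its centre is a line in the fibre over `z.1`, since
  -- `fromChart` is the identity at the centre. Along it `H` is a quadratic polynomial in `t`.
  have hpt (t : ℝ) : φ.symm (φ z + t • ((0 : E), η)) =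
      (⟨z.1, momentum z + t • η⟩ : CotangentBundle E Q) := by
    set β : CotangentBundle E Q := ⟨z.1, momentum z + t • η⟩ with hβ
    have hs : β ∈ φ.source := by
      rw [hφ, extChartAt_source]
      exact mem_chart_cotangent_source.2 (mem_chart_source E z.1)
    rw [← φ.left_inv hs]
    congr 1
    have hm (α : CotangentBundle E Q) (hα : α.1 = z.1) :
        φ α = (extChartAt 𝓘(ℝ, E) z.1 z.1, momentum α) := by
      refine Prod.ext ?_ ?_
      · have hb : α.1 ∈ (chartAt E z.1).source := hα ▸ mem_chart_source E z.1
        rw [← baseSet_cotangent] at hb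
        rw [hφ, extChartAt_totalSpace_fst z α hb, hα]
      · refine ContinuousLinearMap.ext fun v => ?_
        rw [hφ, extChartAt_cotangent_snd_apply, hα, fromChart_self]
        rfl
    rw [hm z rfl, hm β rfl]
    refine Prod.ext (by simp) (by simp; rfl)
  have h3 : HasDerivAt (fun t : ℝ => hamiltonian m U (φ.symm (φ z + t • ((0 : E), η))))
      (η (sharp m z.1 (momentum z))) 0 := by
    have h4 : HasDerivAt (fun t : ℝ => 1 / 2 * (momentum z (sharp m z.1 (momentum z)) +
        2 * t * η (sharp m z.1 (momentum z)) + t ^ 2 * η (sharp m z.1 η)) + U z.1)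
        (1 / 2 * (0 + 2 * 1 * η (sharp m z.1 (momentum z)) +
          (2 * (0 : ℝ) ^ 1 * 1) * η (sharp m z.1 η))) 0 := by
      have hid := hasDerivAt_id (0 : ℝ)
      exact ((((hasDerivAt_const (0 : ℝ) (momentum z (sharp m z.1 (momentum z)))).add
        ((hid.const_mul 2).mul_const _)).add ((hid.pow 2).mul_const _)).const_mul
          (1 / 2)).add_const _
    convert h4 using 1
    · funext t
      rw [hpt, hamiltonian_eq]
      change 1 / 2 * (momentum z + t • η) (sharp m z.1 (momentum z + t • η)) + U z.1 = _
      have := sharp_symm m z.1 (momentum z) η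
      simp only [map_add, map_smul, add_apply, smul_apply, smul_eq_mul, this]
      ring
    · ring
  exact h2.unique h3

/-- The first of Hamilton's equations, obtained by pairing with vertical vectors `(0, η)`. -/
lemma hamiltonianVector_fst (hU : ContMDiff 𝓘(ℝ, E) 𝓘(ℝ, ℝ) ∞ U) (z : CotangentBundle E Q) :
    (hamiltonianVector (hamiltonian m U) z).1 = sharp m z.1 (momentum z) := by
  have key (η : E →L[ℝ] ℝ) :
      η (hamiltonianVector (hamiltonian m U) z).1 = η (sharp m z.1 (momentum z)) := by
    rw [← tderiv_hamiltonian_vertical m hU, ← modelTwoForm_hamiltonianVector, modelTwoForm_apply]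
    simp
  exact (SeparatingDual.eq_iff_forall_dual_eq (R := ℝ)).2 key

namespace ScalingAction

variable (Ψ : ScalingAction E Q) (c : ℝ)

/-- Completing the square; the cross term is `ξ J` and the term quadratic in `ξ` is the one
contained in the augmented potential. -/
lemma hamiltonian_sub_eq (ξ : ℝ) (β : CotangentBundle E Q) :
    hamiltonian m U β - ξ * Ψ.momentumFunction β - augmentedPotential m U Ψ ξ β.1 =
      1 / 2 * metricAt m β.1 (sharp m β.1 (momentum β) - ξ • Ψ.vel β.1)
        (sharp m β.1 (momentum β) - ξ • Ψ.vel β.1) := by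
  rw [hamiltonian_eq, augmentedPotential_eq, momentumFunction]
  simp only [map_sub, sub_apply, metricAt_sharp, map_smul, smul_apply, smul_eq_mul]
  rw [metricAt_symm m β.1 (Ψ.vel β.1) (sharp m β.1 (momentum β)), metricAt_sharp]
  ring

/-- By `hamiltonian_sub_eq` the function `H - ξ J - U_ξ` is nonnegative and vanishes at `z`, so `z`
is a minimum and the differential is zero there. -/
lemma tderiv_hamiltonian_eq (hU : ContMDiff 𝓘(ℝ, E) 𝓘(ℝ, ℝ) ∞ U) {ξ : ℝ}
    {z : CotangentBundle E Q} (hz : sharp m z.1 (momentum z) = ξ • Ψ.vel z.1)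
    (w : E × (E →L[ℝ] ℝ)) :
    tderiv (cotangentModel E) 𝓘(ℝ, ℝ) (hamiltonian m U) z w =
      ξ * tderiv (cotangentModel E) 𝓘(ℝ, ℝ) Ψ.momentumFunction z w +
        tderiv 𝓘(ℝ, E) 𝓘(ℝ, ℝ) (augmentedPotential m U Ψ ξ) z.1 w.1 := by
  have hUξ := Ψ.contMDiff_augmentedPotential m hU ξ
  have h1 := tderiv_eq_fderiv_chart ((contMDiff_hamiltonian m hU).mdifferentiable (by simp) z)
  have h2 := tderiv_eq_fderiv_chart (Ψ.contMDiff_momentumFunction.mdifferentiable (by simp) z)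
  have h3 := tderiv_eq_fderiv_chart
    ((hUξ.comp contMDiff_cotangent_proj).mdifferentiable (by simp) z)
  have h4 := (h1.sub (h2.const_mul ξ)).sub h3
  have hmin : IsLocalMin (fun u => (hamiltonian m U ((extChartAt (cotangentModel E) z).symm u) -
      ξ * Ψ.momentumFunction ((extChartAt (cotangentModel E) z).symm u)) -
      (augmentedPotential m U Ψ ξ ∘ fun β : CotangentBundle E Q => β.1)
        ((extChartAt (cotangentModel E) z).symm u)) (extChartAt (cotangentModel E) z z) := by
    refine Eventually.of_forall fun u => ?_
    simp only [Function.comp_apply, hamiltonian_sub_eq, extChartAt_to_inv]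
    rw [hz, sub_self, map_zero, mul_zero]
    exact mul_nonneg (by norm_num) (metricAt_nonneg _ _ _)
  have h5 := congrArg (fun L => L w) (hmin.hasFDerivAt_eq_zero h4)
  have h6 := tderiv_comp (I := cotangentModel E) (I' := 𝓘(ℝ, E)) (I'' := 𝓘(ℝ, ℝ))
    (g := augmentedPotential m U Ψ ξ) (f := fun β : CotangentBundle E Q => β.1) z
    (hUξ.mdifferentiable (by simp) _) (hasMFDerivAt_totalSpace_proj _).mdifferentiableAt
  have h7 : tderiv (cotangentModel E) 𝓘(ℝ, E)
      (fun α : CotangentBundle E Q => α.1) z = ContinuousLinearMap.fst ℝ _ _ :=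
    mfderiv_totalSpace_proj _
  have h8 : tderiv (cotangentModel E) 𝓘(ℝ, ℝ)
      (augmentedPotential m U Ψ ξ ∘ fun β : CotangentBundle E Q => β.1) z w =
      tderiv 𝓘(ℝ, E) 𝓘(ℝ, ℝ) (augmentedPotential m U Ψ ξ) z.1 w.1 := by
    rw [h7] at h6
    exact congrArg (fun L => L w) h6
  have h9 : tderiv (cotangentModel E) 𝓘(ℝ, ℝ) (hamiltonian m U) z w -
      ξ * tderiv (cotangentModel E) 𝓘(ℝ, ℝ) Ψ.momentumFunction z w -
      tderiv (cotangentModel E) 𝓘(ℝ, ℝ)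
        (augmentedPotential m U Ψ ξ ∘ fun β : CotangentBundle E Q => β.1) z w = 0 := h5
  rw [h8] at h9
  linarith

lemma eq_legendre_iff (ξ : ℝ) (z : CotangentBundle E Q) :
    z = legendre m ⟨z.1, Ψ.generator ξ z.1⟩ ↔ sharp m z.1 (momentum z) = ξ • Ψ.vel z.1 := by
  rw [sharp_eq_iff, ← generator_eq]
  constructor
  · intro h
    exact congrArg momentum h
  · intro h
    exact cotangent_ext rfl h

/-- The central configuration equations say that the Hamiltonian vector field is tangent to the
orbit of the scaled cotangent lift. -/
lemma centralConfiguration_iff (hU : ContMDiff 𝓘(ℝ, E) 𝓘(ℝ, ℝ) ∞ U) (ξ : ℝ)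
    (z : CotangentBundle E Q) :
    (z = legendre m ⟨z.1, Ψ.generator ξ z.1⟩ ∧ CentralConfigurationEquation m U Ψ c ξ z.1) ↔
      hamiltonianVector (hamiltonian m U) z = ξ • Ψ.liftVel c z := by
  rw [eq_legendre_iff, centralConfigurationEquation_iff]
  have key (hz : sharp m z.1 (momentum z) = ξ • Ψ.vel z.1) (w : E × (E →L[ℝ] ℝ)) :
      modelTwoForm E (hamiltonianVector (hamiltonian m U) z) w -
        modelTwoForm E (ξ • Ψ.liftVel c z) w =
      tderiv 𝓘(ℝ, E) 𝓘(ℝ, ℝ) (augmentedPotential m U Ψ ξ) z.1 w.1 +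
        c * ξ * metricAt m z.1 (Ψ.generator ξ z.1) w.1 := by
    have h1 : metricAt m z.1 (Ψ.generator ξ z.1) w.1 = momentum z w.1 := by
      rw [generator_eq, ← hz, metricAt_sharp]
    rw [modelTwoForm_smul, modelTwoForm_hamiltonianVector, Ψ.tderiv_hamiltonian_eq m hU hz, h1,
      modelTwoForm_liftVel]
    ring
  constructor
  · rintro ⟨hz, h⟩
    refine modelTwoForm_ext fun w => ?_
    rw [← sub_eq_zero, key hz, h]
  · intro h
    -- Projecting `X_H = ξ Z` to `Q` recovers the Legendre condition, after which `key` applies.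
    have hz : sharp m z.1 (momentum z) = ξ • Ψ.vel z.1 := by
      rw [← hamiltonianVector_fst m hU, h, ← Ψ.liftVel_fst c]
      rfl
    refine ⟨hz, fun w => ?_⟩
    have := key hz (w, 0)
    rw [h, sub_self] at this
    exact this.symm

end ScalingAction

end RelativeEquilibria

/-! ### Homogeneity of the Hamiltonian and of its vector field. -/

section Scaling

variable {E : Type*} [NormedAddCommGroup E] [NormedSpace ℝ E]
  {Q : Type*} [TopologicalSpace Q] [ChartedSpace E Q] [IsManifold 𝓘(ℝ, E) ∞ Q]
  {m : Metric E Q} {U : Q → ℝ} {Ψ : ScalingAction E Q} {a b c : ℝ}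

namespace ScalingAction

/-- Polarization of the scaling law for the kinetic energy. -/
lemma metricAt_tact
    (hKa : ∀ (g : PosReal) (v : TangentBundle 𝓘(ℝ, E) Q),
      kineticEnergy m (tangentMap 𝓘(ℝ, E) 𝓘(ℝ, E) (Ψ.act g) v) = (g : ℝ) ^ a * kineticEnergy m v)
    (g : PosReal) (q : Q) (v w : E) :
    metricAt m (Ψ.act g q) (Ψ.tact g q v) (Ψ.tact g q w) = (g : ℝ) ^ a * metricAt m q v w := by
  have h (v : E) : metricAt m (Ψ.act g q) (Ψ.tact g q v) (Ψ.tact g q v) =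
      (g : ℝ) ^ a * metricAt m q v v := by
    have h1 : 1 / 2 * metricAt m (Ψ.act g q) (Ψ.tact g q v) (Ψ.tact g q v) =
        (g : ℝ) ^ a * (1 / 2 * metricAt m q v v) := hKa g ⟨q, v⟩
    linarith
  have h1 := h (v + w)
  simp only [map_add, add_apply, h v, h w] at h1
  rw [metricAt_symm m _ (Ψ.tact g q w), metricAt_symm m _ w v] at h1
  linarith

variable [FiniteDimensional ℝ E]

lemma sharp_cotangentLift
    (hKa : ∀ (g : PosReal) (v : TangentBundle 𝓘(ℝ, E) Q),
      kineticEnergy m (tangentMap 𝓘(ℝ, E) 𝓘(ℝ, E) (Ψ.act g) v) = (g : ℝ) ^ a * kineticEnergy m v)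
    (g : PosReal) (β : CotangentBundle E Q) :
    sharp m (Ψ.act g β.1) (momentum (Ψ.cotangentLift c g β)) =
      (g : ℝ) ^ (c - a) • Ψ.tact g β.1 (sharp m β.1 (momentum β)) := by
  rw [sharp_eq_iff]
  refine ContinuousLinearMap.ext fun w => ?_
  have h1 : Ψ.tact g β.1 (Ψ.tact g⁻¹ (Ψ.act g β.1) w) = w :=
    congrArg (fun L => L w) (Ψ.tact_comp_inv g β.1)
  have h2 := metricAt_tact hKa g β.1 (sharp m β.1 (momentum β)) (Ψ.tact g⁻¹ (Ψ.act g β.1) w)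
  rw [h1, metricAt_sharp] at h2
  rw [map_smul, smul_apply, h2, momentum_cotangentLift, smul_eq_mul, ← mul_assoc,
    ← Real.rpow_add g.2, sub_add_cancel]
  rfl

/-- The kinetic part scales by `g^{2c - a}`, and `c = (a + b) / 2` is what makes this equal the
factor `g^b` of the potential. -/
lemma hamiltonian_cotangentLift (hUb : ∀ (g : PosReal) (q : Q), U (Ψ.act g q) = (g : ℝ) ^ b * U q)
    (hKa : ∀ (g : PosReal) (v : TangentBundle 𝓘(ℝ, E) Q),
      kineticEnergy m (tangentMap 𝓘(ℝ, E) 𝓘(ℝ, E) (Ψ.act g) v) = (g : ℝ) ^ a * kineticEnergy m v)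
    (hc : c = (a + b) / 2) (g : PosReal) (β : CotangentBundle E Q) :
    hamiltonian m U (Ψ.cotangentLift c g β) = (g : ℝ) ^ b * hamiltonian m U β := by
  have h1 : Ψ.tact g⁻¹ (Ψ.act g β.1) (Ψ.tact g β.1 (sharp m β.1 (momentum β))) =
      sharp m β.1 (momentum β) :=
    congrArg (fun L => L (sharp m β.1 (momentum β))) (Ψ.tact_inv_comp g β.1)
  have h2 : (g : ℝ) ^ (c - a) * (g : ℝ) ^ c = (g : ℝ) ^ b := by
    rw [← Real.rpow_add g.2]
    congr 1
    rw [hc]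
    ring
  rw [hamiltonian_eq, hamiltonian_eq, cotangentLift_fst, sharp_cotangentLift hKa, hUb,
    momentum_cotangentLift, map_smul, smul_apply, ContinuousLinearMap.comp_apply, h1, smul_eq_mul,
    smul_eq_mul, ← mul_assoc ((g : ℝ) ^ (c - a)), h2]
  ring

/-- In `i_X ω = dH` the right side scales by `g^b` and `ω` by `g^c`; the exponent `b - c` is the
difference. -/
lemma hamiltonianVector_cotangentLift (hU : ContMDiff 𝓘(ℝ, E) 𝓘(ℝ, ℝ) ∞ U)
    (hUb : ∀ (g : PosReal) (q : Q), U (Ψ.act g q) = (g : ℝ) ^ b * U q)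
    (hKa : ∀ (g : PosReal) (v : TangentBundle 𝓘(ℝ, E) Q),
      kineticEnergy m (tangentMap 𝓘(ℝ, E) 𝓘(ℝ, E) (Ψ.act g) v) = (g : ℝ) ^ a * kineticEnergy m v)
    (hc : c = (a + b) / 2) (g : PosReal) (β : CotangentBundle E Q) :
    hamiltonianVector (hamiltonian m U) (Ψ.cotangentLift c g β) =
      (g : ℝ) ^ (b - c) • Ψ.tlift c g β (hamiltonianVector (hamiltonian m U) β) := by
  have hH := contMDiff_hamiltonian m hU
  have hd := hH.mdifferentiable (by simp)
  refine modelTwoForm_ext fun w => ?_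
  obtain ⟨w, rfl⟩ := Ψ.tlift_surjective c g β w
  rw [modelTwoForm_smul, modelTwoForm_tlift, modelTwoForm_hamiltonianVector,
    modelTwoForm_hamiltonianVector, ← mul_assoc, ← Real.rpow_add g.2, sub_add_cancel]
  have h1 := tderiv_comp (I'' := 𝓘(ℝ, ℝ)) β (hd _) (Ψ.mdifferentiableAt_cotangentLift c g β)
  have h2 : (fun β => hamiltonian m U (Ψ.cotangentLift c g β)) =
      fun β => (g : ℝ) ^ b * hamiltonian m U β := funext (hamiltonian_cotangentLift hUb hKa hc g)
  have h3 := tderiv_comp (I' := 𝓘(ℝ, ℝ)) (I'' := 𝓘(ℝ, ℝ)) (g := fun x : ℝ => (g : ℝ) ^ b * x) β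
    (mdifferentiableAt_iff_differentiableAt.2 (by fun_prop)) (hd β)
  rw [h2] at h1
  refine (congrArg (fun L => L w) (h1.symm.trans h3)).trans ?_
  have h4 : HasFDerivAt (fun x : ℝ => (g : ℝ) ^ b * x) ((g : ℝ) ^ b • ContinuousLinearMap.id ℝ ℝ)
      (hamiltonian m U β) := (hasFDerivAt_id (𝕜 := ℝ) _).const_mul _
  rw [tderiv_eq_fderiv, h4.fderiv]
  rfl

end ScalingAction

end Scaling

/-! ### Curves contained in an orbit are tangent to it. -/

section LocalInjectivity

variable {W : Type*} [NormedAddCommGroup W] [NormedSpace ℝ W] [FiniteDimensional ℝ W]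

/-- A curve which moves along the orbits of a local flow is tangent to the orbits. -/
lemma exists_eq_smul_of_flow {f : ℝ × W → W} {g : ℝ → W} {X : W}
    (hf : ContDiffAt ℝ ∞ f (0, g 0)) (h0 : ∀ᶠ u in 𝓝 (g 0), f (0, u) = u)
    (hg : HasStrictDerivAt g X 0) (hZ : fderiv ℝ f (0, g 0) (1, 0) ≠ 0) {σ : ℝ → ℝ} {δ : ℝ}
    (hδ : 0 < δ) (h : ∀ t ∈ Ioo (-δ) δ, ∀ t' ∈ Ioo (-δ) δ, g t = f (σ t - σ t', g t')) :
    ∃ ξ : ℝ, X = ξ • fderiv ℝ f (0, g 0) (1, 0) := by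
  by_contra! hne
  have : CompleteSpace W := FiniteDimensional.complete ℝ W
  set Z := fderiv ℝ f (0, g 0) (1, 0) with hZdef
  have hfs : HasStrictFDerivAt f (fderiv ℝ f (0, g 0)) (0, g 0) := hf.hasStrictFDerivAt (by simp)
  have hid (w : W) : fderiv ℝ f (0, g 0) (0, w) = w := by
    have h1 : HasFDerivAt (fun u => f (0, u)) _ (g 0) :=
      hfs.hasFDerivAt.comp (g 0) (hasFDerivAt_prodMk_right 0 _)
    have h2 := h1.unique ((hasFDerivAt_id (𝕜 := ℝ) (g 0)).congr_of_eventuallyEq h0)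
    exact congrArg (fun L => L w) h2
  have he : HasStrictFDerivAt (fun p : ℝ × ℝ => (p.1, g p.2)) ((ContinuousLinearMap.fst ℝ ℝ ℝ).prod
      ((ContinuousLinearMap.toSpanSingleton ℝ X).comp (ContinuousLinearMap.snd ℝ ℝ ℝ))) (0, 0) := by
    have h1 : HasStrictFDerivAt g (ContinuousLinearMap.toSpanSingleton ℝ X) (0 : ℝ × ℝ).2 :=
      hg.hasStrictFDerivAt
    exact hasStrictFDerivAt_fst.prodMk (h1.comp (0 : ℝ × ℝ) hasStrictFDerivAt_snd)
  set L := (fderiv ℝ f (0, g 0)).comp ((ContinuousLinearMap.fst ℝ ℝ ℝ).prod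
      ((ContinuousLinearMap.toSpanSingleton ℝ X).comp (ContinuousLinearMap.snd ℝ ℝ ℝ))) with hL
  have hG : HasStrictFDerivAt (fun p : ℝ × ℝ => f (p.1, g p.2)) L (0, 0) :=
    HasStrictFDerivAt.comp (g := f) (0, 0) hfs he
  have hLa (p : ℝ × ℝ) : L p = p.1 • Z + p.2 • X := by
    have h1 : (p.1, p.2 • X) = p.1 • ((1 : ℝ), (0 : W)) + ((0 : ℝ), p.2 • X) := by simp
    change fderiv ℝ f (0, g 0) (p.1, p.2 • X) = _
    rw [h1, map_add, map_smul, hid]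
  -- With `Z ≠ 0` and `X` not a multiple of `Z`, the derivative `(s, t) ↦ s Z + t X` is injective.
  have hker : LinearMap.ker (L : ℝ × ℝ →ₗ[ℝ] W) = ⊥ := by
    refine LinearMap.ker_eq_bot'.2 fun p hp => ?_
    have hp : p.1 • Z + p.2 • X = 0 := (hLa p).symm.trans hp
    have h2 : p.2 = 0 := by
      by_contra h2
      refine hne (-(p.2⁻¹ * p.1)) ?_
      rw [neg_smul, mul_smul, eq_neg_of_add_eq_zero_left hp, smul_neg, neg_neg, smul_smul,
        inv_mul_cancel₀ h2, one_smul]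
    rw [h2, zero_smul, add_zero] at hp
    exact Prod.ext ((smul_eq_zero.1 hp).resolve_right hZ) h2
  -- Composing with a linear left inverse `P` gives derivative the identity, so the inverse function
  -- theorem yields local injectivity of `(s, t) ↦ f (s, g t)`.
  obtain ⟨P, hP⟩ := LinearMap.exists_leftInverse_of_injective _ hker
  have hPL : (P.toContinuousLinearMap).comp L =
      (ContinuousLinearEquiv.refl ℝ (ℝ × ℝ) : ℝ × ℝ →L[ℝ] ℝ × ℝ) :=
    ContinuousLinearMap.ext fun p => congrArg (fun M => M p) hP
  have hPG : HasStrictFDerivAt (fun p : ℝ × ℝ => P.toContinuousLinearMap (f (p.1, g p.2)))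
      (ContinuousLinearEquiv.refl ℝ (ℝ × ℝ) : ℝ × ℝ →L[ℝ] ℝ × ℝ) (0, 0) := by
    rw [← hPL]
    exact (P.toContinuousLinearMap.hasStrictFDerivAt).comp ((0, 0) : ℝ × ℝ) hG
  obtain ⟨ε₁, hε₁, hinj⟩ := Metric.eventually_nhds_iff.1 hPG.eventually_left_inverse
  have hgc : ∀ᶠ t in 𝓝 (0 : ℝ), f (0, g t) = g t := hg.hasDerivAt.continuousAt.eventually h0
  obtain ⟨ε₂, hε₂, hg2⟩ := Metric.eventually_nhds_iff.1 hgc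
  set ε := min δ (min ε₁ ε₂) with hε
  have hεpos : 0 < ε := lt_min hδ (lt_min hε₁ hε₂)
  -- Nothing is known about `σ`, not even continuity. But an interval is uncountable and the
  -- integers are countable, so two distinct times have values of `σ` in the same cell of length
  -- `ε`.
  have hninj : ¬ InjOn (fun t => ⌊σ t / ε⌋) (Ioo (-ε) ε) := by
    intro hi
    have h1 : (Ioo (-ε) ε).Countable :=
      countable_of_injective_of_countable_image hi (to_countable _)
    rw [Cardinal.Real.Ioo_countable_iff] at h1
    linarith
  simp only [InjOn, not_forall] at hninj
  obtain ⟨t, ht, t', ht', hfl, htt⟩ := hninj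
  have hσ : |σ t - σ t'| < ε := by
    have h1 := Int.abs_sub_lt_one_of_floor_eq_floor hfl
    rwa [← sub_div, abs_div, abs_of_pos hεpos, div_lt_one hεpos] at h1
  have hεδ : ε ≤ δ := min_le_left _ _
  have hε1 : ε ≤ ε₁ := (min_le_right _ _).trans (min_le_left _ _)
  have hε2 : ε ≤ ε₂ := (min_le_right _ _).trans (min_le_right _ _)
  have hsub : Ioo (-ε) ε ⊆ Ioo (-δ) δ := Ioo_subset_Ioo (by linarith) hεδ
  have habs {x : ℝ} (hx : x ∈ Ioo (-ε) ε) : |x| < ε := abs_lt.2 hx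
  -- The collision: `(0, t)` and `(σ t - σ t', t')` both lie in the region of injectivity and have
  -- the same image, contradicting `t ≠ t'`.
  have heq : f (0, g t) = f (σ t - σ t', g t') := by
    rw [← h t (hsub ht) t' (hsub ht')]
    exact hg2 (by rw [Real.dist_0_eq_abs]; exact (habs ht).trans_le hε2)
  have hd (s x : ℝ) (hs : |s| < ε) (hx : |x| < ε) : dist (s, x) ((0, 0) : ℝ × ℝ) < ε₁ := by
    rw [Prod.dist_eq, Real.dist_0_eq_abs, Real.dist_0_eq_abs]
    exact (max_lt hs hx).trans_le hε1
  have h1 := hinj (hd 0 t (by simpa using hεpos) (habs ht))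
  have h2 := hinj (hd (σ t - σ t') t' hσ (habs ht'))
  simp only [heq] at h1
  exact htt (congrArg Prod.snd (h1.symm.trans h2))

end LocalInjectivity

section IntegralCurves

variable {F H M : Type*} [NormedAddCommGroup F] [NormedSpace ℝ F] [TopologicalSpace H]
  {I : ModelWithCorners ℝ F H} [TopologicalSpace M] [ChartedSpace H M]

lemma hasMFDerivAt_of_tderiv {γ : ℝ → M} {t : ℝ} (hγ : MDifferentiableAt 𝓘(ℝ, ℝ) I γ t) {v : F}
    (hv : tderiv 𝓘(ℝ, ℝ) I γ t 1 = v) :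
    HasMFDerivAt 𝓘(ℝ, ℝ) I γ t ((1 : ℝ →L[ℝ] ℝ).smulRight v : ℝ →L[ℝ] F) := by
  have h1 : tderiv 𝓘(ℝ, ℝ) I γ t = (1 : ℝ →L[ℝ] ℝ).smulRight v := by
    refine ContinuousLinearMap.ext_ring ?_
    rw [hv]
    simp
  rw [← h1]
  exact hγ.hasMFDerivAt

variable [IsManifold I 1 M] {X : ∀ x : M, TangentSpace I x}

/-- The velocity `X (γ t)` is continuous in `t`, which upgrades the derivative to a strict one, as
the inverse function theorem requires. -/
lemma hasStrictDerivAt_extChartAt_integralCurve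
    (hX : ContMDiff I I.tangent 1 (fun x => (⟨x, X x⟩ : TangentBundle I M)))
    {γ : ℝ → M} {S : Set ℝ} (hS : S ∈ 𝓝 0) (hγ : IsMIntegralCurveOn γ X S) :
    HasStrictDerivAt (fun t => extChartAt I (γ 0) (γ t)) (X (γ 0) : F) 0 := by
  have hc : ContinuousAt γ 0 := ((hγ 0 (mem_of_mem_nhds hS)).hasMFDerivAt hS).continuousAt
  have hm : ∀ᶠ t in 𝓝 (0 : ℝ), γ t ∈ (chartAt H (γ 0)).source :=
    hc.preimage_mem_nhds (chart_source_mem_nhds H (γ 0))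
  have hd : ∀ᶠ t in 𝓝 (0 : ℝ), HasDerivAt (fun t => extChartAt I (γ 0) (γ t))
      (tderiv I 𝓘(ℝ, F) (extChartAt I (γ 0)) (γ t) (X (γ t))) t := by
    filter_upwards [hm, eventually_mem_nhds_iff.2 hS] with t ht htS
    have h1 : HasMFDerivAt 𝓘(ℝ, ℝ) I γ t ((1 : ℝ →L[ℝ] ℝ).smulRight (X (γ t)) : ℝ →L[ℝ] F) :=
      (hγ t (mem_of_mem_nhds htS)).hasMFDerivAt htS
    have h2 : HasFDerivAt (fun t => extChartAt I (γ 0) (γ t))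
        ((tderiv I 𝓘(ℝ, F) (extChartAt I (γ 0)) (γ t)).comp
          ((1 : ℝ →L[ℝ] ℝ).smulRight (X (γ t) : F))) t :=
      hasMFDerivAt_iff_hasFDerivAt.1
        ((mdifferentiableAt_extChartAt (I := I) ht).hasMFDerivAt.comp t h1)
    exact h2.hasDerivAt.congr_deriv (congrArg (tderiv I 𝓘(ℝ, F) (extChartAt I (γ 0)) (γ t))
      (one_smul ℝ (X (γ t) : F)))
  have hcont : ContinuousAt
      (fun t => tderiv I 𝓘(ℝ, F) (extChartAt I (γ 0)) (γ t) (X (γ t))) 0 := by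
    have h1 : ContinuousAt (fun x => (trivializationAt F (TangentSpace I) (γ 0)
        (⟨x, X x⟩ : TangentBundle I M)).2) (γ 0) :=
      (contMDiffAt_totalSpace.1 (hX (γ 0))).2.continuousAt
    have h2 : ContinuousAt (fun t => (trivializationAt F (TangentSpace I) (γ 0)
        (⟨γ t, X (γ t)⟩ : TangentBundle I M)).2) 0 :=
      ContinuousAt.comp (g := fun x => (trivializationAt F (TangentSpace I) (γ 0)
        (⟨x, X x⟩ : TangentBundle I M)).2) h1 hc
    refine h2.congr (hm.mono fun t ht => ?_)
    exact tderiv_extChartAt_eq_trivializationAt ht _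
  have h := hasStrictDerivAt_of_hasDerivAt_of_continuousAt hd hcont
  rwa [tderiv_extChartAt_self] at h

end IntegralCurves

section Orbits

variable {E : Type*} [NormedAddCommGroup E] [NormedSpace ℝ E]
  {Q : Type*} [TopologicalSpace Q] [ChartedSpace E Q] [IsManifold 𝓘(ℝ, E) ∞ Q]

namespace ScalingAction

variable (Ψ : ScalingAction E Q) (c : ℝ)

/-- The group law transports the derivative at time `0` to time `s`. -/
lemma tderiv_liftFlow (s : ℝ) (z : CotangentBundle E Q) :
    tderiv 𝓘(ℝ, ℝ) (cotangentModel E) (fun t => Ψ.liftFlow c t z) s 1 =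
      Ψ.tlift c (posExp s) z (Ψ.liftVel c z) := by
  have h0 : (fun t => Ψ.liftFlow c t z) =
      fun t => Ψ.cotangentLift c (posExp s) (Ψ.liftFlow c (t - s) z) := by
    funext t
    rw [← liftFlow, ← liftFlow_add, add_sub_cancel]
  have hm := (contMDiff_flow_left (Ψ.contMDiff_liftFlow c) z).mdifferentiable (by simp)
  have hs : MDifferentiableAt 𝓘(ℝ, ℝ) 𝓘(ℝ, ℝ) (fun t : ℝ => t - s) s :=
    mdifferentiableAt_iff_differentiableAt.2 (by fun_prop)
  have h1 := tderiv_comp (I := 𝓘(ℝ, ℝ)) (I' := 𝓘(ℝ, ℝ)) (I'' := cotangentModel E)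
    (g := fun t => Ψ.liftFlow c t z) (f := fun t => t - s) s (hm _) hs
  have h2 := tderiv_comp (I := 𝓘(ℝ, ℝ)) (I' := cotangentModel E) (I'' := cotangentModel E)
    (g := Ψ.cotangentLift c (posExp s)) (f := fun t => Ψ.liftFlow c (t - s) z) s
    (Ψ.mdifferentiableAt_cotangentLift c _ _) ((hm _).comp s hs)
  have h3 : HasFDerivAt (fun t : ℝ => t - s) (ContinuousLinearMap.id ℝ ℝ) s :=
    (hasFDerivAt_id s).sub_const s
  rw [tderiv_eq_fderiv, h3.fderiv, sub_self, ContinuousLinearMap.comp_id] at h1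
  rw [h1, sub_self, liftFlow_zero] at h2
  rw [h0, h2]
  rfl

lemma hasMFDerivAt_liftFlow {σ : ℝ → ℝ} {σ' t : ℝ} (hσ : HasDerivAt σ σ' t)
    (z : CotangentBundle E Q) :
    HasMFDerivAt 𝓘(ℝ, ℝ) (cotangentModel E) (fun t => Ψ.liftFlow c (σ t) z) t
      ((1 : ℝ →L[ℝ] ℝ).smulRight (σ' • Ψ.tlift c (posExp (σ t)) z (Ψ.liftVel c z)) :
        ℝ →L[ℝ] E × (E →L[ℝ] ℝ)) := by
  have hm := (contMDiff_flow_left (Ψ.contMDiff_liftFlow c) z).mdifferentiable (by simp) (σ t)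
  have hs : MDifferentiableAt 𝓘(ℝ, ℝ) 𝓘(ℝ, ℝ) σ t :=
    mdifferentiableAt_iff_differentiableAt.2 hσ.differentiableAt
  have h1 := tderiv_comp (I := 𝓘(ℝ, ℝ)) (I' := 𝓘(ℝ, ℝ)) (I'' := cotangentModel E)
    (g := fun t => Ψ.liftFlow c t z) (f := σ) t hm hs
  have h3 : MDifferentiableAt 𝓘(ℝ, ℝ) (cotangentModel E) (fun t => Ψ.liftFlow c (σ t) z) t :=
    hm.comp t hs
  refine hasMFDerivAt_of_tderiv h3 ?_
  rw [h1, tderiv_eq_fderiv, ← tderiv_liftFlow]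
  have h2 : fderiv ℝ σ t 1 = σ' • (1 : ℝ) := by
    rw [hσ.hasFDerivAt.fderiv]
    simp
  rw [ContinuousLinearMap.comp_apply, h2, map_smul]

/-- A zero of the generator is a fixed point. -/
lemma liftFlow_eq_self [T2Space Q] [FiniteDimensional ℝ E] {z : CotangentBundle E Q}
    (hz : Ψ.liftVel c z = 0) (s : ℝ) : Ψ.liftFlow c s z = z := by
  have : T2Space (CotangentBundle E Q) := t2Space_totalSpace
  have : CompleteSpace E := FiniteDimensional.complete ℝ E
  have h0 : ContMDiff (cotangentModel E) (cotangentModel E).tangent 1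
      (fun β : CotangentBundle E Q =>
        (⟨β, 0⟩ : TangentBundle (cotangentModel E) (CotangentBundle E Q))) :=
    Bundle.contMDiff_zeroSection ℝ (TangentSpace (cotangentModel E))
  -- The orbit has zero velocity at all times by `tderiv_liftFlow`, so it and the constant curve are
  -- integral curves of the zero field and uniqueness identifies them.
  have h1 : IsMIntegralCurve (fun t => Ψ.liftFlow c t z)
      (fun β => (0 : TangentSpace (cotangentModel E) β)) := by
    intro t
    have h2 := Ψ.hasMFDerivAt_liftFlow c (hasDerivAt_id t) z
    rw [hz, map_zero, smul_zero] at h2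
    exact h2
  have h3 : IsMIntegralCurve (fun _ : ℝ => z)
      (fun β => (0 : TangentSpace (cotangentModel E) β)) :=
    isMIntegralCurve_const rfl
  have h4 := isMIntegralCurve_eq_of_contMDiff (t₀ := 0)
    (fun t => BoundarylessManifold.isInteriorPoint) h0 h1 h3 (Ψ.liftFlow_zero c z)
  exact congrFun h4 s

/-- An integral curve which moves along an orbit is tangent to it. -/
lemma exists_eq_smul_liftVel [T2Space Q] [FiniteDimensional ℝ E]
    {X : ∀ β : CotangentBundle E Q, TangentSpace (cotangentModel E) β}
    (hX : ContMDiff (cotangentModel E) (cotangentModel E).tangent 1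
      (fun β => (⟨β, X β⟩ : TangentBundle (cotangentModel E) (CotangentBundle E Q))))
    {γ : ℝ → CotangentBundle E Q} {S : Set ℝ} {z : CotangentBundle E Q}
    (hγ : IsIntegralCurveFrom X z γ S) {η : ℝ → PosReal}
    (hη : ∀ᶠ t in 𝓝 (0 : ℝ), γ t = Ψ.cotangentLift c (η t) z) :
    ∃ ξ : ℝ, (X z : E × (E →L[ℝ] ℝ)) = ξ • Ψ.liftVel c z := by
  have hS : S ∈ 𝓝 0 := hγ.isOpen.mem_nhds hγ.zero_mem
  have hd := hasStrictDerivAt_extChartAt_integralCurve hX hS hγ.integral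
  have hc : ContinuousAt γ 0 :=
    ((hγ.integral 0 hγ.zero_mem).hasMFDerivAt hS).continuousAt
  have hη' : ∀ᶠ t in 𝓝 (0 : ℝ), γ t = Ψ.liftFlow c (Real.log (η t)) z :=
    hη.mono fun t ht => by rw [ht, liftFlow, posExp_log]
  rw [hγ.initial] at hd
  -- If the generator vanishes, the orbit is a point, `γ` is constant near `0`, and `X z = 0`.
  -- Otherwise `exists_eq_smul_of_flow` applies.
  by_cases hz : Ψ.liftVel c z = 0
  · refine ⟨0, ?_⟩
    have h1 : (fun t => extChartAt (cotangentModel E) z (γ t)) =ᶠ[𝓝 0]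
        fun _ => extChartAt (cotangentModel E) z z :=
      hη'.mono fun t ht => by simp only [ht, Ψ.liftFlow_eq_self c hz]
    have h2 := hd.hasDerivAt.unique ((hasDerivAt_const (0 : ℝ) _).congr_of_eventuallyEq h1)
    rw [zero_smul]
    exact h2
  · have hm : ∀ᶠ t in 𝓝 (0 : ℝ), γ t ∈ (chartAt (ModelProd E (E →L[ℝ] ℝ)) z).source := by
      refine hc.preimage_mem_nhds ?_
      rw [hγ.initial]
      exact chart_source_mem_nhds _ z
    obtain ⟨δ, hδ, h⟩ := Metric.eventually_nhds_iff.1 (hη'.and hm)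
    have hball {t : ℝ} (ht : t ∈ Ioo (-δ) δ) : dist t 0 < δ := by
      rw [Real.dist_0_eq_abs]
      exact abs_lt.2 ht
    have hsm := Ψ.contMDiff_liftFlow c
    have hzt := mem_extChartAt_target (I := cotangentModel E) z
    have hgen : Ψ.liftVel c z = fderiv ℝ (flowInChart (cotangentModel E) (Ψ.liftFlow c) z)
        (0, extChartAt (cotangentModel E) z z) (1, 0) := by
      have h1 := tderiv_extChartAt_flowGenerator hsm (Ψ.liftFlow_zero c)
        (mem_chart_source (ModelProd E (E →L[ℝ] ℝ)) z)
      rwa [tderiv_extChartAt_self] at h1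
    have h1 := exists_eq_smul_of_flow (f := flowInChart (cotangentModel E) (Ψ.liftFlow c) z)
      (g := fun t => extChartAt (cotangentModel E) z (γ t)) (σ := fun t => Real.log (η t))
      (X := X z) ?_ ?_ hd ?_ hδ ?_
    · simp only [hγ.initial] at h1
      rwa [← hgen] at h1
    · simp only [hγ.initial]
      exact contDiffAt_flowInChart hsm (Ψ.liftFlow_zero c) z hzt
    · simp only [hγ.initial]
      filter_upwards [extChartAt_target_mem_nhds (I := cotangentModel E) z] with u hu
      exact flowInChart_zero (Ψ.liftFlow_zero c) z hu
    · simp only [hγ.initial]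
      rwa [← hgen]
    · intro t ht t' ht'
      rw [flowInChart_apply _ (h (hball ht')).2, (h (hball ht)).1, (h (hball ht')).1,
        ← liftFlow_add, sub_add_cancel]

end ScalingAction

end Orbits

/-! ### Reparametrised orbits as integral curves, and passage to maximal ones. -/

section ScalingTime

/-- The solution of `σ' = ξ e^{kσ}`, `σ 0 = 0`, valid as long as `k ξ t < 1`. -/
def scalingTime (k ξ t : ℝ) : ℝ := if k = 0 then ξ * t else -Real.log (1 - k * ξ * t) / k

lemma scalingTime_zero (k ξ : ℝ) : scalingTime k ξ 0 = 0 := by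
  simp [scalingTime]

lemma hasDerivAt_scalingTime {k ξ t : ℝ} (ht : k * ξ * t < 1) :
    HasDerivAt (scalingTime k ξ) (Real.exp (scalingTime k ξ t * k) * ξ) t := by
  have hpos : 0 < 1 - k * ξ * t := sub_pos.2 ht
  by_cases hk : k = 0
  · have h1 : scalingTime k ξ = fun t => ξ * t := by
      funext t
      rw [scalingTime, if_pos hk]
    rw [h1, hk, mul_zero, Real.exp_zero, one_mul]
    simpa using (hasDerivAt_id t).const_mul ξ
  · have h1 : scalingTime k ξ = fun t => -Real.log (1 - k * ξ * t) / k := by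
      funext t
      rw [scalingTime, if_neg hk]
    have h2 : HasDerivAt (fun t => 1 - k * ξ * t) (-(k * ξ)) t := by
      simpa using ((hasDerivAt_id t).const_mul (k * ξ)).const_sub 1
    have h3 := ((h2.log hpos.ne').neg).div_const k
    rw [h1]
    refine h3.congr_deriv ?_
    rw [div_mul_cancel₀ _ hk, Real.exp_neg, Real.exp_log hpos]
    field_simp

end ScalingTime

section Symmetry

variable {E : Type*} [NormedAddCommGroup E] [NormedSpace ℝ E]
  {Q : Type*} [TopologicalSpace Q] [ChartedSpace E Q] [IsManifold 𝓘(ℝ, E) ∞ Q]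
  {Ψ : ScalingAction E Q} {c k ξ : ℝ}
  {X : ∀ β : CotangentBundle E Q, TangentSpace (cotangentModel E) β} {z : CotangentBundle E Q}
  {γ : ℝ → CotangentBundle E Q} {S : Set ℝ}

namespace ScalingAction

/-- A vector field which is multiplied by powers of `g` has an integral curve along every orbit to
which it is tangent. -/
lemma isIntegralCurveFrom_liftFlow
    (hX : ∀ g β, (X (Ψ.cotangentLift c g β) : E × (E →L[ℝ] ℝ)) =
      (g : ℝ) ^ k • Ψ.tlift c g β (X β))
    (hz : (X z : E × (E →L[ℝ] ℝ)) = ξ • Ψ.liftVel c z) :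
    IsIntegralCurveFrom X z (fun t => Ψ.liftFlow c (scalingTime k ξ t) z)
      {t | k * ξ * t < 1} where
  isOpen := isOpen_lt (by fun_prop) continuous_const
  ordConnected := by
    refine ⟨fun x hx y hy w hw => ?_⟩
    change k * ξ * w < 1
    rcases le_total 0 (k * ξ) with h | h
    · exact (mul_le_mul_of_nonneg_left hw.2 h).trans_lt hy
    · exact (mul_le_mul_of_nonpos_left hw.1 h).trans_lt hx
  zero_mem := by simp
  initial := by rw [scalingTime_zero, liftFlow_zero]
  integral := by
    intro t ht
    have h1 := Ψ.hasMFDerivAt_liftFlow c (hasDerivAt_scalingTime ht) z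
    -- At the point `Φ_{e^σ}(z)` homogeneity gives `X` the factor `e^{kσ} ξ`, which is `σ'`.
    have h2 : (X (Ψ.liftFlow c (scalingTime k ξ t) z) : E × (E →L[ℝ] ℝ)) =
        (Real.exp (scalingTime k ξ t * k) * ξ) •
          Ψ.tlift c (posExp (scalingTime k ξ t)) z (Ψ.liftVel c z) := by
      rw [liftFlow, hX, hz, map_smul, posExp_rpow, smul_smul]
    rw [← h2] at h1
    exact h1.hasMFDerivWithinAt

/-- If the maximal integral curve leaves the orbit, then it does so at a fixed point. -/
lemma exists_fixedPoint_of_not_subset [T2Space Q]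
    (hX : ∀ g β, (X (Ψ.cotangentLift c g β) : E × (E →L[ℝ] ℝ)) =
      (g : ℝ) ^ k • Ψ.tlift c g β (X β))
    (hz : (X z : E × (E →L[ℝ] ℝ)) = ξ • Ψ.liftVel c z) (hγ : IsMaximalIntegralCurve X z γ S)
    (hS : ¬ S ⊆ {t | k * ξ * t < 1}) :
    ∃ t ∈ S, ∀ g, Ψ.cotangentLift c g (γ t) = γ t := by
  have : T2Space (CotangentBundle E Q) := t2Space_totalSpace
  obtain ⟨t, htS, ht⟩ := not_subset.1 hS
  have ht : 1 ≤ k * ξ * t := not_lt.1 ht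
  have hkξ : k * ξ ≠ 0 := by
    intro h
    rw [h, zero_mul] at ht
    linarith
  have hk : k ≠ 0 := left_ne_zero_of_mul hkξ
  -- The instant at which `scalingTime` blows up lies between `0` and `t`, hence in the domain of
  -- `γ`.
  have htm : (k * ξ)⁻¹ ∈ S := by
    refine hγ.ordConnected.uIcc_subset hγ.zero_mem htS ?_
    rw [mem_uIcc]
    rcases lt_or_gt_of_ne hkξ with h | h
    · right
      refine ⟨?_, (inv_lt_zero.2 h).le⟩
      rw [← one_div, le_div_iff_of_neg h]
      linarith
    · left
      refine ⟨(inv_pos.2 h).le, ?_⟩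
      rw [← one_div, div_le_iff₀ h]
      linarith
  refine ⟨_, htm, fun g => ?_⟩
  have heq := (hγ.maximal _ _ (isIntegralCurveFrom_liftFlow hX hz)).2
  -- Here `u = 1 - k ξ t` is the rescaled time left before the blow-up, and `u → 0⁺` approaches it.
  have hG {u : ℝ} (hu : 0 < u) :
      γ ((k * ξ)⁻¹ * (1 - u)) = Ψ.liftFlow c (-Real.log u / k) z := by
    have h1 : k * ξ * ((k * ξ)⁻¹ * (1 - u)) = 1 - u := mul_inv_cancel_left₀ hkξ _
    have h2 : (k * ξ)⁻¹ * (1 - u) ∈ {t | k * ξ * t < 1} := by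
      rw [mem_ofPred_eq, h1]
      linarith
    rw [← heq h2]
    simp only [scalingTime, if_neg hk, h1, sub_sub_cancel]
  have hγc : ContinuousAt γ (k * ξ)⁻¹ :=
    ((hγ.integral _ htm).hasMFDerivAt (hγ.isOpen.mem_nhds htm)).continuousAt
  have hlim (r : ℝ) : Tendsto (fun u : ℝ => γ ((k * ξ)⁻¹ * (1 - r * u))) (𝓝[>] 0)
      (𝓝 (γ (k * ξ)⁻¹)) := by
    refine Tendsto.comp hγc (Tendsto.mono_left ?_ nhdsWithin_le_nhds)
    have h1 : Continuous fun u : ℝ => (k * ξ)⁻¹ * (1 - r * u) := by fun_prop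
    simpa using h1.tendsto 0
  have h1 := ((Ψ.contMDiff_cotangentLift c g).continuous.tendsto _).comp (hlim 1)
  -- Multiplying `u` by `e^{-k log g}` adds `log g` to `-log u / k`, that is, applies `Φ_g`. Both
  -- families tend to `γ (kξ)⁻¹`, so this limit is fixed by `Φ_g`.
  refine tendsto_nhds_unique (h1.congr' ?_) (hlim (Real.exp (-(k * Real.log g))))
  filter_upwards [self_mem_nhdsWithin] with u (hu : 0 < u)
  rw [Function.comp_apply, one_mul, hG hu, hG (mul_pos (Real.exp_pos _) hu),
    Real.log_mul (Real.exp_pos _).ne' hu.ne', Real.log_exp]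
  have h2 : -(-(k * Real.log g) + Real.log u) / k = Real.log g + -Real.log u / k := by
    field_simp
    ring
  rw [h2, liftFlow_add]
  change _ = Ψ.cotangentLift c (posExp (Real.log g)) _
  rw [posExp_log]

lemma liftVel_eq_zero (hz : ∀ g, Ψ.cotangentLift c g z = z) : Ψ.liftVel c z = 0 := by
  have h1 : (fun τ => Ψ.liftFlow c τ z) = fun _ => z := funext fun τ => hz _
  rw [liftVel, flowGenerator, h1]
  have h2 : tderiv 𝓘(ℝ, ℝ) (cotangentModel E) (fun _ : ℝ => z) 0 = 0 := mfderiv_const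
  rw [h2]
  rfl

variable [T2Space Q] [FiniteDimensional ℝ E]

lemma exists_isMaximalIntegralCurve_cotangent
    (hXs : ContMDiff (cotangentModel E) (cotangentModel E).tangent 1
      (fun β => (⟨β, X β⟩ : TangentBundle (cotangentModel E) (CotangentBundle E Q))))
    (z : CotangentBundle E Q) :
    ∃ (γ : ℝ → CotangentBundle E Q) (S : Set ℝ), IsMaximalIntegralCurve X z γ S := by
  have : T2Space (CotangentBundle E Q) := t2Space_totalSpace
  have : CompleteSpace E := FiniteDimensional.complete ℝ E
  exact exists_isMaximalIntegralCurve hXs z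

lemma isLocalRelativeEquilibrium_iff
    (hXs : ContMDiff (cotangentModel E) (cotangentModel E).tangent 1
      (fun β => (⟨β, X β⟩ : TangentBundle (cotangentModel E) (CotangentBundle E Q))))
    (hX : ∀ g β, (X (Ψ.cotangentLift c g β) : E × (E →L[ℝ] ℝ)) =
      (g : ℝ) ^ k • Ψ.tlift c g β (X β)) (z : CotangentBundle E Q) :
    IsLocalRelativeEquilibrium X (Ψ.cotangentLift c) z ↔
      ∃ ξ : ℝ, (X z : E × (E →L[ℝ] ℝ)) = ξ • Ψ.liftVel c z := by
  constructor
  · rintro ⟨γ, S, hγ, η, -, hη⟩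
    exact Ψ.exists_eq_smul_liftVel c hXs hγ.toIsIntegralCurveFrom hη
  · rintro ⟨ξ, hξ⟩
    obtain ⟨γ, S, hγ⟩ := exists_isMaximalIntegralCurve_cotangent hXs z
    have h0 := isIntegralCurveFrom_liftFlow hX hξ
    refine ⟨γ, S, hγ, fun t => posExp (scalingTime k ξ t), ?_, ?_⟩
    · simp only [scalingTime_zero, posExp_zero]
    · filter_upwards [h0.isOpen.mem_nhds h0.zero_mem] with t ht
      exact ((hγ.maximal _ _ h0).2 ht).symm

lemma isRelativeEquilibrium_iff
    (hXs : ContMDiff (cotangentModel E) (cotangentModel E).tangent 1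
      (fun β => (⟨β, X β⟩ : TangentBundle (cotangentModel E) (CotangentBundle E Q))))
    (hX : ∀ g β, (X (Ψ.cotangentLift c g β) : E × (E →L[ℝ] ℝ)) =
      (g : ℝ) ^ k • Ψ.tlift c g β (X β)) (z : CotangentBundle E Q) :
    IsRelativeEquilibrium X (Ψ.cotangentLift c) z ↔
      (∃ ξ : ℝ, (X z : E × (E →L[ℝ] ℝ)) = ξ • Ψ.liftVel c z) ∧
        AvoidsFixedPoints X (Ψ.cotangentLift c) z := by
  constructor
  · rintro ⟨γ, S, hγ, η, h1, hη⟩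
    refine ⟨(isLocalRelativeEquilibrium_iff hXs hX z).1 ⟨γ, S, hγ, η, h1, ?_⟩, ?_⟩
    · filter_upwards [hγ.isOpen.mem_nhds hγ.zero_mem] with t ht
      exact hη t ht
    · intro δ T hδ t ht hfix g
      obtain ⟨hTS, heq⟩ := hγ.maximal δ T hδ.toIsIntegralCurveFrom
      rw [heq ht, hη t (hTS ht)] at hfix
      have h2 := Ψ.eq_of_cotangentLift_fixed c hfix
      rw [h2] at hfix
      exact hfix g
  · rintro ⟨⟨ξ, hξ⟩, hav⟩
    obtain ⟨γ, S, hγ⟩ := exists_isMaximalIntegralCurve_cotangent hXs z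
    -- At a fixed point the generator and `X z` vanish, so `ξ` may be replaced by `0`, for which the
    -- condition `k ξ t < 1` holds at all times. Otherwise avoidance rules out leaving the orbit.
    obtain ⟨ξ, hξ, hS⟩ : ∃ ξ : ℝ, (X z : E × (E →L[ℝ] ℝ)) = ξ • Ψ.liftVel c z ∧
        S ⊆ {t | k * ξ * t < 1} := by
      by_cases hfix : ∀ g, Ψ.cotangentLift c g z = z
      · refine ⟨0, ?_, fun t _ => by simp⟩
        rw [hξ, liftVel_eq_zero hfix, smul_zero, smul_zero]
      · refine ⟨ξ, hξ, ?_⟩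
        by_contra hS
        obtain ⟨t, ht, h⟩ := exists_fixedPoint_of_not_subset hX hξ hγ hS
        exact hfix (hav γ S hγ t ht h)
    refine ⟨γ, S, hγ, fun t => posExp (scalingTime k ξ t), ?_, fun t ht => ?_⟩
    · simp only [scalingTime_zero, posExp_zero]
    · exact ((hγ.maximal _ _ (isIntegralCurveFrom_liftFlow hX hξ)).2 (hS ht)).symm

end ScalingAction

end Symmetry

end ScalingMechanics

end

theorem mainTheorem3 {E : Type*} [NormedAddCommGroup E] [NormedSpace ℝ E] [FiniteDimensional ℝ E]
    {Q : Type*} [TopologicalSpace Q] [T2Space Q] [ChartedSpace E Q] [IsManifold 𝓘(ℝ, E) ∞ Q]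
    (m : ScalingMechanics.Metric E Q) (U : Q → ℝ) (hU : ContMDiff 𝓘(ℝ, E) 𝓘(ℝ, ℝ) ∞ U)
    (Ψ : ScalingMechanics.ScalingAction E Q) (a b c : ℝ)
    (hUb : ∀ (g : ScalingMechanics.PosReal) (q : Q), U (Ψ.act g q) = (g : ℝ) ^ b * U q)
    (hKa : ∀ (g : ScalingMechanics.PosReal) (v : TangentBundle 𝓘(ℝ, E) Q),
      ScalingMechanics.kineticEnergy m (tangentMap 𝓘(ℝ, E) 𝓘(ℝ, E) (Ψ.act g) v) =
        (g : ℝ) ^ a * ScalingMechanics.kineticEnergy m v)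
    (hc : c = (a + b) / 2) (z : ScalingMechanics.CotangentBundle E Q) :
    (ScalingMechanics.IsRelativeEquilibrium
          (ScalingMechanics.hamiltonianVectorField (ScalingMechanics.hamiltonian m U))
          (Ψ.cotangentLift c) z ↔
        (∃ ξ : ℝ, z = ScalingMechanics.legendre m ⟨z.1, Ψ.generator ξ z.1⟩ ∧
          ScalingMechanics.CentralConfigurationEquation m U Ψ c ξ z.1) ∧
        ScalingMechanics.AvoidsFixedPoints
          (ScalingMechanics.hamiltonianVectorField (ScalingMechanics.hamiltonian m U))
          (Ψ.cotangentLift c) z) ∧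
      (ScalingMechanics.IsLocalRelativeEquilibrium
          (ScalingMechanics.hamiltonianVectorField (ScalingMechanics.hamiltonian m U))
          (Ψ.cotangentLift c) z ↔
        ∃ ξ : ℝ, z = ScalingMechanics.legendre m ⟨z.1, Ψ.generator ξ z.1⟩ ∧
          ScalingMechanics.CentralConfigurationEquation m U Ψ c ξ z.1) ∧
      ((∀ q : Q, ∃ g : ScalingMechanics.PosReal, Ψ.act g q ≠ q) →
        (ScalingMechanics.IsRelativeEquilibrium
            (ScalingMechanics.hamiltonianVectorField (ScalingMechanics.hamiltonian m U))
            (Ψ.cotangentLift c) z ↔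
          ∃ ξ : ℝ, z = ScalingMechanics.legendre m ⟨z.1, Ψ.generator ξ z.1⟩ ∧
            ScalingMechanics.CentralConfigurationEquation m U Ψ c ξ z.1)) := by
  have hH := ScalingMechanics.contMDiff_hamiltonian m hU
  have hXs := (ScalingMechanics.contMDiff_hamiltonianVectorField hH).of_le
    (m := 1) (by simp)
  have hX := ScalingMechanics.ScalingAction.hamiltonianVector_cotangentLift hU hUb hKa hc
  have hC : (∃ ξ : ℝ, z = ScalingMechanics.legendre m ⟨z.1, Ψ.generator ξ z.1⟩ ∧
      ScalingMechanics.CentralConfigurationEquation m U Ψ c ξ z.1) ↔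
      ∃ ξ : ℝ, ScalingMechanics.hamiltonianVector (ScalingMechanics.hamiltonian m U) z =
        ξ • Ψ.liftVel c z :=
    exists_congr fun ξ => Ψ.centralConfiguration_iff m c hU ξ z
  have h1 := ScalingMechanics.ScalingAction.isRelativeEquilibrium_iff hXs hX z
  rw [hC]
  refine ⟨h1, ScalingMechanics.ScalingAction.isLocalRelativeEquilibrium_iff hXs hX z,
    fun hfix => h1.trans (and_iff_left ?_)⟩
  -- A fixed point of `Φ` lies over a fixed point of `Ψ`, so without the latter avoidance holds
  -- vacuously.
  intro γ S _ t _ h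
  obtain ⟨g, hg⟩ := hfix (γ t).1
  exact absurd (congrArg (fun β => β.1) (h g)) hg
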